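/- **Setting.** Let $d\ge 0$ and $\mathbb T^d=\mathbb R^d/\mathbb Z^d$. Functions on $\mathbb T^d$ are $\mathbb Z^d$-periodic functions on $\mathbb R^d$; a map $\mathbb T^d\to\mathbb T^d$ is a map $\mathbb R^d\to\mathbb R^d$ that sends points that are equal mod $\mathbb Z^d$ to points that are equal mod $\mathbb Z^d$. Elements of $\mathscr P(\mathbb T^d)$ are represented by Borel probability measures on $\mathbb R^d$, two of them being identified when they integrate all continuous periodic functions equally, and $\mathscr W(\mu,\nu)^2=\inf_\gamma\int |x-y|_{\mathbb T^d}^2\,\gamma(dx,dy)$ over the couplings $\gamma$ of $\mu$ and $\nu$, where $|x-y|_{\mathbb T^d}=\min_{n\in\mathbb Z^d}|x-y+n|$. Let $\kappa>0$ and let $(H,F,g)$ satisfy: $H=H(q,p)\in C^3(\mathbb T^d\times\mathbb R^d)$; the functions $F,g:\mathbb T^d\times\mathscr P(\mathbb T^d)\to\mathbb R$ are continuous in $\mu$, of class $C^3$ in $q$ with $|\nabla_qF|,|\nabla^2_{qq}F|,|\nabla^3_{qqq}F|\le\kappa$, and $$|\nabla_qF(q_1,\mu_1)-\nabla_qF(q_2,\mu_2)|\le\kappa\sqrt{|q_1-q_2|^2+\mathscr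 W(\mu_1,\mu_2)^2},$$ and likewise for $g$. **Theorem.** There is $T_0>0$, depending only on $(H,F,g)$ and $\kappa$, such that for all $0<T\le T_0$, $0<s<T$ and $\mu\in\mathscr P(\mathbb T^d)$ the following hold. 1. There is a unique continuous $(\Sigma^1,\Sigma^2):[0,T]\times\mathbb T^d\to\mathbb T^d\times\mathbb R^d$ which solves, for $t\in[0,T]$ and all $q$, $$\partial_t\Sigma^1=\nabla_pH(\Sigma^1,\Sigma^2),\qquad \partial_t\Sigma^2=-\nabla_qH(\Sigma^1,\Sigma^2)-\nabla_qF(\Sigma^1,\sigma_t),$$ $$\Sigma^1(s,q)=q,\qquad \Sigma^2(0,q)=\nabla_qg(\Sigma^1(0,q),\sigma_0),\qquad\text{where } \sigma_t:=(\Sigma^1_t)_\#\mu,$$ and $\Sigma^1_t:\mathbb R^d\to\mathbb R^d$ is bijective for every $t\in[0,T]$. 2. Put $$z(t,q)=g(\Sigma^1_0(q),\sigma_0)+\int_0^t\big[\Sigma^2_\tau\cdot\nabla_pH(\Sigma^1_\tau,\Sigma^2_\tau)-H(\Sigma^1_\tau,\Sigma^2_\tau)-F(\Sigma^1_\tau,\sigma_\tau)\big](q)\,d\tau,\qquad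 U(t,x)=z\big(t,(\Sigma^1_t)^{-1}(x)\big).$$ Then $(U,\sigma)$ is a classical solution of the first-order mean field game system: $U$ is periodic in $q$, continuous on $[0,T)\times\mathbb T^d$ and of class $C^1$ on $(0,T)\times\mathbb T^d$; $\sigma\in AC^2(0,T;\mathscr P(\mathbb T^d))$, that is, $\mathscr W(\sigma_{t_1},\sigma_{t_2})\le\int_{t_1}^{t_2}m$ for $0<t_1\le t_2<T$ and some $m\in L^2(0,T)$, and $\sigma_t\to\sigma_0$ as $t\to0^+$; $$\partial_tU(t,q)+H(q,\nabla_qU(t,q))+F(q,\sigma_t)=0\quad\text{for all }(t,q)\in(0,T)\times\mathbb T^d;$$ $$\int_0^T\!\!\int\big[\partial_t\varphi(t,q)+\nabla\varphi(t,q)\cdot\nabla_pH(q,\nabla_qU(t,q))\big]\sigma_t(dq)\,dt=0\quad\text{for all }\varphi\in C_c^\infty((0,T)\times\mathbb T^d);$$ $U(0,\cdot)=g(\cdot,\sigma_0)$ and $\sigma_s=\mu$. Moreover $U(t,\cdot)$ is differentiable at $\Sigma^1_t(q)$ with $\nabla_qU(t,\Sigma^1_t(q))=\Sigma^2_t(q)$,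 for all $t\in[0,T]$ and $q$. 3. $U\in W^{1,2;\infty}((0,T)\times\mathbb T^d)$: $U$, its first weak derivative in $t$ and its weak derivatives of order one and two in $q$ are essentially bounded. If moreover $F$ is Lipschitz in $\mu$, i.e. $|F(q,\nu_1)-F(q,\nu_2)|\le L\,\mathscr W(\nu_1,\nu_2)$ for some $L$ and all $q,\nu_1,\nu_2$, then $U\in W^{2,2;\infty}((0,T)\times\mathbb T^d)$: also the second weak derivative in $t$ is essentially bounded. -/

import Mathlib

open MeasureTheory Set Filter Topology
open scoped ContDiff

noncomputable section

namespace MFG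

/-- The Euclidean space in which points of the torus are represented. -/
abbrev Rd (d : ℕ) := EuclideanSpace ℝ (Fin d)

variable {d : ℕ}

/-! ### The torus, through periodic objects on the Euclidean space -/

/-- The vector of the Euclidean space with the given integer coordinates. -/
def latticeVec (n : Fin d → ℤ) : Rd d := WithLp.toLp 2 fun i => (n i : ℝ)

/-- A map defined on the torus: a map on `ℝ^d` that is `ℤ^d`-periodic. -/
def TorusPeriodic {S : Type*} (f : Rd d → S) : Prop :=
  ∀ (x : Rd d) (n : Fin d → ℤ), f (x + latticeVec n) = f x

/-- A map from the torus to the torus: equivalent points have equivalent images. -/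
def IsTorusMap (f : Rd d → Rd d) : Prop :=
  ∀ (x : Rd d) (n : Fin d → ℤ), ∃ m : Fin d → ℤ, f (x + latticeVec n) = f x + latticeVec m

/-- The flat distance of the torus, the least distance between representatives. -/
def torusDist (x y : Rd d) : ℝ := ⨅ n : Fin d → ℤ, ‖x - y + latticeVec n‖

/-- Two probability measures on `ℝ^d` represent the same probability measure on the torus if they
have the same integrals of continuous periodic functions. -/
def TorusEquiv (μ ν : ProbabilityMeasure (Rd d)) : Prop :=
  ∀ φ : Rd d → ℝ, Continuous φ → TorusPeriodic φ →
    ∫ x, φ x ∂(μ : Measure (Rd d)) = ∫ x, φ x ∂(ν : Measure (Rd d))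

/-- The quadratic Wasserstein distance of the torus. Probability measures on the torus are
represented by probability measures on `ℝ^d`; the cost is bounded, and each class contains a
measure carried by the unit cube, so that no moment condition is needed. -/
def torusW (μ ν : ProbabilityMeasure (Rd d)) : ℝ :=
  Real.sqrt (sInf {c : ℝ | ∃ γ : Measure (Rd d × Rd d),
    γ.map Prod.fst = (μ : Measure (Rd d)) ∧ γ.map Prod.snd = (ν : Measure (Rd d)) ∧
      c = ∫ z, torusDist z.1 z.2 ^ 2 ∂γ})

open Classical in
/-- The pushforward of a probability measure (with the junk value `μ` if the map is not
measurable; below the map is always continuous). -/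
def pushforward (f : Rd d → Rd d) (μ : ProbabilityMeasure (Rd d)) : ProbabilityMeasure (Rd d) :=
  if hf : AEMeasurable f (μ : Measure (Rd d)) then μ.map hf else μ

/-! ### The coefficients -/

/-- The gradient of `H` in the position variable. -/
def gradHq (H : Rd d → Rd d → ℝ) (q p : Rd d) : Rd d := gradient (fun q' => H q' p) q

/-- The gradient of `H` in the momentum variable. -/
def gradHp (H : Rd d → Rd d → ℝ) (q p : Rd d) : Rd d := gradient (fun p' => H q p') p

/-- The gradient of a coupling function in the position variable. -/
def gradq (F : Rd d → ProbabilityMeasure (Rd d) → ℝ) (q : Rd d)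
    (μ : ProbabilityMeasure (Rd d)) : Rd d := gradient (fun q' => F q' μ) q

/-- A Hamiltonian of class `C³` on the product of the torus and the Euclidean space. -/
structure IsHamiltonian (H : Rd d → Rd d → ℝ) : Prop where
  contDiff : ContDiff ℝ 3 fun z : Rd d × Rd d => H z.1 z.2
  periodic : ∀ p : Rd d, TorusPeriodic fun q => H q p

/-- The conditions on the couplings `F` and `g`, functions of a point of the torus and a
probability measure on the torus. -/
structure IsCoupling (κ : ℝ) (F : Rd d → ProbabilityMeasure (Rd d) → ℝ) : Prop where
  periodic : ∀ μ, TorusPeriodic fun q => F q μ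
  invariant : ∀ q μ ν, TorusEquiv μ ν → F q μ = F q ν
  continuous_measure : ∀ q μ, ∀ ε > 0, ∃ δ > 0, ∀ ν, torusW μ ν < δ → |F q ν - F q μ| < ε
  contDiff : ∀ μ, ContDiff ℝ 3 fun q => F q μ
  bound : ∀ μ q, ∀ k ∈ Finset.Icc 1 3, ‖iteratedFDeriv ℝ k (fun q' => F q' μ) q‖ ≤ κ
  lipschitz : ∀ q₁ q₂ μ₁ μ₂,
    ‖gradq F q₁ μ₁ - gradq F q₂ μ₂‖ ≤ κ * Real.sqrt (‖q₁ - q₂‖ ^ 2 + torusW μ₁ μ₂ ^ 2)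

/-! ### The characteristics and the pair built from them -/

/-- `(Q, P)` is a continuous map from `[0,T] × 𝕋^d` to `𝕋^d × ℝ^d` that solves the Hamiltonian
system of characteristics with parameters `s` and `μ`. Values at times outside `[0,T]` play
no role. -/
structure IsCharacteristicFlow (H : Rd d → Rd d → ℝ)
    (F g : Rd d → ProbabilityMeasure (Rd d) → ℝ) (T s : ℝ) (μ : ProbabilityMeasure (Rd d))
    (Q P : ℝ → Rd d → Rd d) : Prop where
  continuous_Q : ContinuousOn (fun z : ℝ × Rd d => Q z.1 z.2) (Icc 0 T ×ˢ univ)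
  continuous_P : ContinuousOn (fun z : ℝ × Rd d => P z.1 z.2) (Icc 0 T ×ˢ univ)
  torusMap_Q : ∀ t ∈ Icc 0 T, IsTorusMap (Q t)
  periodic_P : ∀ t ∈ Icc 0 T, TorusPeriodic (P t)
  ode_Q : ∀ t ∈ Icc 0 T, ∀ q,
    HasDerivWithinAt (fun τ => Q τ q) (gradHp H (Q t q) (P t q)) (Icc 0 T) t
  ode_P : ∀ t ∈ Icc 0 T, ∀ q,
    HasDerivWithinAt (fun τ => P τ q)
      (-gradHq H (Q t q) (P t q) - gradq F (Q t q) (pushforward (Q t) μ)) (Icc 0 T) t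
  terminal_Q : ∀ q, Q s q = q
  initial_P : ∀ q, P 0 q = gradq g (Q 0 q) (pushforward (Q 0) μ)

/-- The value `z(t,q)` carried by the characteristic through `q`. -/
def characteristicValue (H : Rd d → Rd d → ℝ) (F g : Rd d → ProbabilityMeasure (Rd d) → ℝ)
    (μ : ProbabilityMeasure (Rd d)) (Q P : ℝ → Rd d → Rd d) (t : ℝ) (q : Rd d) : ℝ :=
  g (Q 0 q) (pushforward (Q 0) μ) +
    ∫ τ in (0 : ℝ)..t, (inner ℝ (P τ q) (gradHp H (Q τ q) (P τ q)) - H (Q τ q) (P τ q)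
      - F (Q τ q) (pushforward (Q τ) μ))

/-- The function `U(t,x) = z(t, X(t,x))`, with `X(t,·)` the inverse of `Q(t,·)`. -/
def valueFunction (H : Rd d → Rd d → ℝ) (F g : Rd d → ProbabilityMeasure (Rd d) → ℝ)
    (μ : ProbabilityMeasure (Rd d)) (Q P : ℝ → Rd d → Rd d) (t : ℝ) (x : Rd d) : ℝ :=
  characteristicValue H F g μ Q P t (Function.invFun (Q t) x)

/-! ### Absolutely continuous paths, classical solutions, Sobolev spaces -/

/-- Paths in `AC²(0,T; 𝒫(𝕋^d))`. -/
def IsAC2 (T : ℝ) (σ : ℝ → ProbabilityMeasure (Rd d)) : Prop :=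
  ∃ m : ℝ → ℝ, MemLp m 2 (volume.restrict (Ioo 0 T)) ∧
    ∀ t₁ t₂, 0 < t₁ → t₁ ≤ t₂ → t₂ < T → torusW (σ t₁) (σ t₂) ≤ ∫ τ in t₁..t₂, m τ

/-- Smooth functions on `(0,T) × 𝕋^d` with compact support. -/
structure IsTorusTest (T : ℝ) (φ : ℝ × Rd d → ℝ) : Prop where
  contDiff : ContDiff ℝ ∞ φ
  periodic : ∀ t, TorusPeriodic fun q => φ (t, q)
  support : ∃ a b, 0 < a ∧ b < T ∧ ∀ t, t ∉ Icc a b → ∀ q, φ (t, q) = 0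

/-- Classical solutions `(U, σ)` of the first-order mean field game system on `(0,T) × 𝕋^d` with
coefficients `(H, F, g)` and parameters `s` and `μ`. The continuity of `U` and `σ` at time `0` is
what gives the initial condition a meaning. -/
structure IsClassicalSolution (H : Rd d → Rd d → ℝ)
    (F g : Rd d → ProbabilityMeasure (Rd d) → ℝ) (T s : ℝ) (μ : ProbabilityMeasure (Rd d))
    (U : ℝ → Rd d → ℝ) (σ : ℝ → ProbabilityMeasure (Rd d)) : Prop where
  periodic : ∀ t ∈ Ico 0 T, TorusPeriodic (U t)
  contDiff : ContDiffOn ℝ 1 (fun z : ℝ × Rd d => U z.1 z.2) (Ioo 0 T ×ˢ univ)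
  continuous : ContinuousOn (fun z : ℝ × Rd d => U z.1 z.2) (Ico 0 T ×ˢ univ)
  ac2 : IsAC2 T σ
  tendsto_zero : Tendsto (fun t => torusW (σ t) (σ 0)) (𝓝[>] 0) (𝓝 0)
  hamiltonJacobi : ∀ t ∈ Ioo 0 T, ∀ q,
    deriv (fun τ => U τ q) t + H q (gradient (U t) q) + F q (σ t) = 0
  continuityEquation : ∀ φ : ℝ × Rd d → ℝ, IsTorusTest T φ →
    ∫ t in Ioo 0 T, ∫ q, (deriv (fun τ => φ (τ, q)) t +
      inner ℝ (gradient (fun q' => φ (t, q')) q) (gradHp H q (gradient (U t) q)))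
        ∂(σ t : Measure (Rd d)) = 0
  initial : ∀ q, U 0 q = g q (σ 0)
  terminal : TorusEquiv (σ s) μ

/-- The time-space cylinder, with periodicity left to the functions on it. -/
def cylinder (d : ℕ) (T : ℝ) : Set (ℝ × Rd d) := Ioo 0 T ×ˢ univ

/-- `v` is the weak derivative of `u` in direction `e` on the cylinder. -/
def IsWeakDeriv (T : ℝ) (e : ℝ × Rd d) (u v : ℝ × Rd d → ℝ) : Prop :=
  ∀ φ : ℝ × Rd d → ℝ, ContDiff ℝ ∞ φ → HasCompactSupport φ → tsupport φ ⊆ cylinder d T →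
    ∫ z in cylinder d T, u z * fderiv ℝ φ z e = -∫ z in cylinder d T, v z * φ z

/-- Essentially bounded measurable functions on the cylinder. -/
def EssBounded (T : ℝ) (u : ℝ × Rd d → ℝ) : Prop := MemLp u ⊤ (volume.restrict (cylinder d T))

/-- `W^{1,2;∞}((0,T) × 𝕋^d)`: functions periodic in `q`, essentially bounded together with their
first weak derivative in `t` and their weak derivatives up to order two in `q`. -/
structure MemW12 (T : ℝ) (u : ℝ → Rd d → ℝ) : Prop where
  periodic : ∀ t ∈ Ioo 0 T, TorusPeriodic (u t)
  essBounded : EssBounded T fun z => u z.1 z.2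
  time : ∃ v : ℝ × Rd d → ℝ, EssBounded T v ∧ IsWeakDeriv T (1, 0) (fun z => u z.1 z.2) v
  space : ∃ (G : Fin d → ℝ × Rd d → ℝ) (D : Fin d → Fin d → ℝ × Rd d → ℝ),
    (∀ i, EssBounded T (G i) ∧
      IsWeakDeriv T (0, EuclideanSpace.single i 1) (fun z => u z.1 z.2) (G i)) ∧
    ∀ i j, EssBounded T (D i j) ∧ IsWeakDeriv T (0, EuclideanSpace.single j 1) (G i) (D i j)

/-- `W^{2,2;∞}((0,T) × 𝕋^d)`: in addition, the second weak derivative in `t` is essentially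
bounded. -/
structure MemW22 (T : ℝ) (u : ℝ → Rd d → ℝ) : Prop extends MemW12 T u where
  time_two : ∃ v w : ℝ × Rd d → ℝ, EssBounded T v ∧ EssBounded T w ∧
    IsWeakDeriv T (1, 0) (fun z => u z.1 z.2) v ∧ IsWeakDeriv T (1, 0) v w

end MFG

end

open MFG

/-!
The proof follows the method of characteristics, arranged so that the flow `(Q, P)` never has to be
differentiated with respect to its initial point: Lipschitz estimates suffice.

*The flow.* A characteristic starts with a momentum of norm at most `κ`, and on a short interval it
cannot leave the ball of radius `κ + 1` (`IsShortTime.norm_momentum_le`), so only bounds of `H` over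
a ball of momenta matter (`HamiltonianBounds`). Two characteristics with terminal points `q`, `q'`
and driven by paths of measures at distance at most `w` stay within a multiple of `‖q - q'‖ + w` of
one another, and their displacement differs from `q - q'` by at most half of that
(`IsShortTime.stability`). The Wasserstein distance of two pushforwards of `μ` is at most
the uniform distance of the maps, so this one estimate gives uniqueness, periodicity, Lipschitz
dependence on the point, and bijectivity of `Q t`. Existence is a two-point boundary value problem
for an ordinary differential equation with Lipschitz right-hand side in the space of bounded
continuous maps (`exists_solution_boundary_problem`, `IsShortTime.exists_isCharSystem`), after a
truncation of the momenta that the bound above makes harmless.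

*The value function.* Differentiating in time, one finds that
`z(t,q') - z(t,q) - ⟪P t q, Q t q' - Q t q⟫` is of second order in `q' - q`: the first-order terms
of its derivative cancel because of the Hamiltonian system, and at time `0` because
`P 0 = ∇g(Q 0)` (`IsShortTime.characteristicValue_taylor`). Hence `U(t,·)` has the gradient
`P t ∘ (Q t)⁻¹`, and expanding `U` around one characteristic gives its full differential, which is
continuous and contains the Hamilton–Jacobi equation
(`IsShortTime.hasFDerivWithinAt_valueFunction`). The continuity equation is the fundamental theorem
of calculus along the characteristics, integrated against `μ`.

*Sobolev regularity.* The field `P t ∘ (Q t)⁻¹` is jointly Lipschitz, and so is the time derivative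
`-H - F` when `F` is Lipschitz in the measure. Lipschitz functions have bounded weak derivatives
(`exists_isWeakDeriv_of_lipschitzOnWith`).
-/

namespace MFG

variable {d : ℕ}

/-! ### Periodic functions and the Wasserstein distance of the torus -/

lemma latticeVec_zero : latticeVec (0 : Fin d → ℤ) = 0 := by
  ext i; simp [latticeVec]

lemma exists_norm_add_latticeVec_le (x : Rd d) :
    ∃ n : Fin d → ℤ, ‖x + latticeVec n‖ ≤ Real.sqrt d := by
  refine ⟨fun i => -⌊x i⌋, ?_⟩
  rw [EuclideanSpace.norm_eq]
  refine Real.sqrt_le_sqrt ?_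
  calc ∑ i, ‖(x + latticeVec fun i => -⌊x i⌋) i‖ ^ 2 ≤ ∑ _i : Fin d, (1 : ℝ) := by
        refine Finset.sum_le_sum fun i _ => ?_
        have h : (x + latticeVec fun i => -⌊x i⌋) i = Int.fract (x i) := by
          simp [latticeVec, Int.fract, sub_eq_add_neg]
        rw [h, Real.norm_eq_abs, sq_abs]
        nlinarith [Int.fract_nonneg (x i), Int.fract_lt_one (x i)]
    _ = d := by simp

/-- Periodicity replaces compactness of the torus. -/
lemma exists_forall_norm_le_of_periodic {α E : Type*} [TopologicalSpace α]
    [NormedAddCommGroup E] {K : Set α} (hK : IsCompact K) {f : α → Rd d → E}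
    (hf : ContinuousOn (fun z : α × Rd d => f z.1 z.2) (K ×ˢ univ))
    (hper : ∀ a ∈ K, TorusPeriodic (f a)) :
    ∃ C, 0 ≤ C ∧ ∀ a ∈ K, ∀ q, ‖f a q‖ ≤ C := by
  have hcomp : IsCompact (K ×ˢ Metric.closedBall (0 : Rd d) (Real.sqrt d)) :=
    hK.prod (isCompact_closedBall _ _)
  obtain ⟨C, hC⟩ := hcomp.exists_bound_of_continuousOn
    (hf.mono (prod_mono_right (subset_univ _)))
  refine ⟨max C 0, le_max_right _ _, fun a ha q => ?_⟩
  obtain ⟨n, hn⟩ := exists_norm_add_latticeVec_le q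
  rw [← hper a ha q n]
  exact (hC (a, q + latticeVec n) ⟨ha, by simpa using hn⟩).trans (le_max_left _ _)

lemma torusDist_nonneg (x y : Rd d) : 0 ≤ torusDist x y :=
  Real.iInf_nonneg fun _ => norm_nonneg _

lemma torusDist_le (x y : Rd d) : torusDist x y ≤ ‖x - y‖ := by
  have h := ciInf_le (f := fun n : Fin d → ℤ => ‖x - y + latticeVec n‖)
    ⟨0, by rintro _ ⟨n, rfl⟩; exact norm_nonneg _⟩ 0
  simpa [torusDist, latticeVec_zero] using h

lemma torusW_nonneg (μ ν : ProbabilityMeasure (Rd d)) : 0 ≤ torusW μ ν := Real.sqrt_nonneg _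

lemma coe_pushforward {f : Rd d → Rd d} (hf : Continuous f) (μ : ProbabilityMeasure (Rd d)) :
    (pushforward f μ : Measure (Rd d)) = (μ : Measure (Rd d)).map f := by
  rw [pushforward, dif_pos hf.measurable.aemeasurable]
  rfl

lemma pushforward_eq_self {f : Rd d → Rd d} (hf : ∀ q, f q = q) (μ : ProbabilityMeasure (Rd d)) :
    pushforward f μ = μ := by
  obtain rfl : f = id := funext hf
  apply Subtype.ext
  exact (coe_pushforward continuous_id μ).trans Measure.map_id

/-- The maps `f` and `h` themselves provide a coupling of the two pushforwards. -/
lemma torusW_pushforward_le {f h : Rd d → Rd d} (hf : Continuous f) (hh : Continuous h)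
    (μ : ProbabilityMeasure (Rd d)) {ε : ℝ} (hε : 0 ≤ ε) (hfh : ∀ q, ‖f q - h q‖ ≤ ε) :
    torusW (pushforward f μ) (pushforward h μ) ≤ ε := by
  have hm : Measurable fun q => (f q, h q) := (hf.prodMk hh).measurable
  set γ : Measure (Rd d × Rd d) := (μ : Measure (Rd d)).map fun q => (f q, h q) with hγ
  have : IsProbabilityMeasure γ := Measure.isProbabilityMeasure_map hm.aemeasurable
  have hae : ∀ᵐ z ∂γ, ‖torusDist z.1 z.2 ^ 2‖ ≤ ε ^ 2 := by
    have hset : MeasurableSet {z : Rd d × Rd d | ‖z.1 - z.2‖ ≤ ε} :=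
      (isClosed_le (by fun_prop) continuous_const).measurableSet
    have h1 : ∀ᵐ z ∂γ, ‖z.1 - z.2‖ ≤ ε :=
      (ae_map_iff hm.aemeasurable hset).2 (Eventually.of_forall hfh)
    filter_upwards [h1] with z hz
    rw [Real.norm_of_nonneg (sq_nonneg _)]
    exact pow_le_pow_left₀ (torusDist_nonneg _ _) ((torusDist_le _ _).trans hz) 2
  have hint : ∫ z, torusDist z.1 z.2 ^ 2 ∂γ ≤ ε ^ 2 := by
    refine (le_abs_self _).trans ?_
    simpa using norm_integral_le_of_norm_le_const hae
  rw [torusW]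
  refine Real.sqrt_le_iff.2 ⟨hε, le_trans (csInf_le ?_ ?_) hint⟩
  · refine ⟨0, ?_⟩
    rintro _ ⟨γ', -, -, rfl⟩
    exact integral_nonneg fun _ => sq_nonneg _
  refine ⟨γ, ?_, ?_, rfl⟩
  · rw [coe_pushforward hf, hγ, Measure.map_map measurable_fst hm]
    rfl
  · rw [coe_pushforward hh, hγ, Measure.map_map measurable_snd hm]
    rfl

lemma torusW_self_eq_zero (μ : ProbabilityMeasure (Rd d)) : torusW μ μ = 0 := by
  refine le_antisymm ?_ (torusW_nonneg _ _)
  have h := torusW_pushforward_le continuous_id continuous_id μ le_rfl (by simp)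
  rwa [pushforward_eq_self (f := id) (fun _ => rfl)] at h

/-! ### Quantitative bounds on the coefficients -/

namespace IsCoupling

variable {κ : ℝ} {F : Rd d → ProbabilityMeasure (Rd d) → ℝ}

lemma differentiable (hF : IsCoupling κ F) (μ : ProbabilityMeasure (Rd d)) :
    Differentiable ℝ fun q => F q μ := (hF.contDiff μ).differentiable (by norm_num)

lemma hasGradientAt (hF : IsCoupling κ F) (q : Rd d) (μ : ProbabilityMeasure (Rd d)) :
    HasGradientAt (fun q' => F q' μ) (gradq F q μ) q :=
  (hF.differentiable μ q).hasGradientAt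

lemma norm_fderiv_le (hF : IsCoupling κ F) (q : Rd d) (μ : ProbabilityMeasure (Rd d)) :
    ‖fderiv ℝ (fun q' => F q' μ) q‖ ≤ κ := by
  rw [← norm_iteratedFDeriv_one]
  exact hF.bound μ q 1 (by simp)

lemma norm_gradq_le (hF : IsCoupling κ F) (q : Rd d) (μ : ProbabilityMeasure (Rd d)) :
    ‖gradq F q μ‖ ≤ κ := by
  simpa [gradq, gradient] using hF.norm_fderiv_le q μ

lemma norm_gradq_sub_le (hκ : 0 ≤ κ) (hF : IsCoupling κ F) (q₁ q₂ : Rd d)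
    (μ₁ μ₂ : ProbabilityMeasure (Rd d)) :
    ‖gradq F q₁ μ₁ - gradq F q₂ μ₂‖ ≤ κ * (‖q₁ - q₂‖ + torusW μ₁ μ₂) := by
  refine (hF.lipschitz q₁ q₂ μ₁ μ₂).trans (mul_le_mul_of_nonneg_left ?_ hκ)
  refine Real.sqrt_le_iff.2 ⟨add_nonneg (norm_nonneg _) (torusW_nonneg _ _), ?_⟩
  nlinarith [norm_nonneg (q₁ - q₂), torusW_nonneg μ₁ μ₂,
    mul_nonneg (norm_nonneg (q₁ - q₂)) (torusW_nonneg μ₁ μ₂)]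

lemma abs_sub_le (hF : IsCoupling κ F) (q₁ q₂ : Rd d) (μ : ProbabilityMeasure (Rd d)) :
    |F q₁ μ - F q₂ μ| ≤ κ * ‖q₁ - q₂‖ :=
  Convex.norm_image_sub_le_of_norm_fderiv_le (f := fun q => F q μ)
    (fun q _ => hF.differentiable μ q) (fun q _ => hF.norm_fderiv_le q μ) convex_univ
    (mem_univ q₂) (mem_univ q₁)

/-- The second-order Taylor bound that follows from the Lipschitz bound on the gradient. -/
lemma taylor (hκ : 0 ≤ κ) (hF : IsCoupling κ F) (q q' : Rd d) (μ : ProbabilityMeasure (Rd d)) :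
    |F q' μ - F q μ - inner ℝ (gradq F q μ) (q' - q)| ≤ κ * ‖q' - q‖ ^ 2 := by
  have h := Convex.norm_image_sub_le_of_norm_hasFDerivWithin_le' (f := fun q => F q μ)
    (s := segment ℝ q q') (φ := InnerProductSpace.toDual ℝ (Rd d) (gradq F q μ))
    (C := κ * ‖q' - q‖)
    (fun x _ => (hF.hasGradientAt x μ).hasFDerivAt.hasFDerivWithinAt)
    (fun x hx => by
      rw [← map_sub, LinearIsometryEquiv.norm_map]
      refine (norm_gradq_sub_le hκ hF x q μ μ).trans ?_
      rw [torusW_self_eq_zero, add_zero]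
      exact mul_le_mul_of_nonneg_left (norm_sub_le_of_mem_segment hx) hκ)
    (convex_segment q q') (left_mem_segment ℝ q q') (right_mem_segment ℝ q q')
  simpa [sq, mul_assoc] using h

end IsCoupling

/-- Bounds, for momenta of norm at most `R`, on the gradients of a Hamiltonian, on their Lipschitz
constants, and on the second-order Taylor remainder, all with the same constant `K`. -/
structure HamiltonianBounds (H : Rd d → Rd d → ℝ) (R K : ℝ) : Prop where
  norm_gradHq_le : ∀ q p, ‖p‖ ≤ R → ‖gradHq H q p‖ ≤ K
  norm_gradHp_le : ∀ q p, ‖p‖ ≤ R → ‖gradHp H q p‖ ≤ K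
  norm_gradHq_sub_le : ∀ q q' p p', ‖p‖ ≤ R → ‖p'‖ ≤ R →
    ‖gradHq H q p - gradHq H q' p'‖ ≤ K * (‖q - q'‖ + ‖p - p'‖)
  norm_gradHp_sub_le : ∀ q q' p p', ‖p‖ ≤ R → ‖p'‖ ≤ R →
    ‖gradHp H q p - gradHp H q' p'‖ ≤ K * (‖q - q'‖ + ‖p - p'‖)
  taylor : ∀ q q' p p', ‖p‖ ≤ R → ‖p'‖ ≤ R →
    |H q' p' - H q p - inner ℝ (gradHq H q p) (q' - q) - inner ℝ (gradHp H q p) (p' - p)|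
      ≤ K * (‖q' - q‖ + ‖p' - p‖) ^ 2

lemma HamiltonianBounds.mono {H : Rd d → Rd d → ℝ} {R K K' : ℝ} (h : HamiltonianBounds H R K)
    (hK : K ≤ K') : HamiltonianBounds H R K' where
  norm_gradHq_le q p hp := (h.norm_gradHq_le q p hp).trans hK
  norm_gradHp_le q p hp := (h.norm_gradHp_le q p hp).trans hK
  norm_gradHq_sub_le q q' p p' hp hp' :=
    (h.norm_gradHq_sub_le q q' p p' hp hp').trans (by gcongr)
  norm_gradHp_sub_le q q' p p' hp hp' :=
    (h.norm_gradHp_sub_le q q' p p' hp hp').trans (by gcongr)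
  taylor q q' p p' hp hp' := (h.taylor q q' p p' hp hp').trans (by gcongr)

namespace IsHamiltonian

variable {H : Rd d → Rd d → ℝ}

lemma hasFDerivAt (hH : IsHamiltonian H) (z : Rd d × Rd d) :
    HasFDerivAt (fun z : Rd d × Rd d => H z.1 z.2)
      (fderiv ℝ (fun z : Rd d × Rd d => H z.1 z.2) z) z :=
  (hH.contDiff.differentiable (by norm_num) z).hasFDerivAt

lemma gradHq_eq (hH : IsHamiltonian H) (q p : Rd d) :
    gradHq H q p = (InnerProductSpace.toDual ℝ (Rd d)).symm
      ((fderiv ℝ (fun z : Rd d × Rd d => H z.1 z.2) (q, p)).comp (.inl ℝ _ _)) := by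
  rw [gradHq, gradient]
  congr 1
  exact (HasFDerivAt.comp (f := fun q' => (q', p)) q (hH.hasFDerivAt (q, p))
    (hasFDerivAt_prodMk_left q p)).fderiv

lemma gradHp_eq (hH : IsHamiltonian H) (q p : Rd d) :
    gradHp H q p = (InnerProductSpace.toDual ℝ (Rd d)).symm
      ((fderiv ℝ (fun z : Rd d × Rd d => H z.1 z.2) (q, p)).comp (.inr ℝ _ _)) := by
  rw [gradHp, gradient]
  congr 1
  exact (HasFDerivAt.comp (f := fun p' => (q, p')) p (hH.hasFDerivAt (q, p))
    (hasFDerivAt_prodMk_right q p)).fderiv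

lemma fderiv_apply (hH : IsHamiltonian H) (q p v w : Rd d) :
    fderiv ℝ (fun z : Rd d × Rd d => H z.1 z.2) (q, p) (v, w)
      = inner ℝ (gradHq H q p) v + inner ℝ (gradHp H q p) w := by
  rw [hH.gradHq_eq, hH.gradHp_eq, InnerProductSpace.toDual_symm_apply,
    InnerProductSpace.toDual_symm_apply]
  simp [← map_add]

lemma continuous_fderiv (hH : IsHamiltonian H) :
    Continuous (fderiv ℝ fun z : Rd d × Rd d => H z.1 z.2) :=
  hH.contDiff.continuous_fderiv (by norm_num)

lemma continuous_gradHq (hH : IsHamiltonian H) :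
    Continuous fun z : Rd d × Rd d => gradHq H z.1 z.2 := by
  simp only [hH.gradHq_eq]
  exact (LinearIsometryEquiv.continuous _).comp (hH.continuous_fderiv.clm_comp continuous_const)

lemma continuous_gradHp (hH : IsHamiltonian H) :
    Continuous fun z : Rd d × Rd d => gradHp H z.1 z.2 := by
  simp only [hH.gradHp_eq]
  exact (LinearIsometryEquiv.continuous _).comp (hH.continuous_fderiv.clm_comp continuous_const)

lemma gradHq_add_latticeVec (hH : IsHamiltonian H) (q p : Rd d) (n : Fin d → ℤ) :
    gradHq H (q + latticeVec n) p = gradHq H q p := by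
  rw [gradHq, gradHq, gradient, gradient, ← fderiv_comp_add_right]
  congr 2
  exact funext fun x => hH.periodic p x n

lemma gradHp_add_latticeVec (hH : IsHamiltonian H) (q p : Rd d) (n : Fin d → ℤ) :
    gradHp H (q + latticeVec n) p = gradHp H q p := by
  rw [gradHp, gradHp]
  congr 1
  exact funext fun p' => hH.periodic p' q n

lemma exists_bounds (hH : IsHamiltonian H) (R : ℝ) : ∃ K, HamiltonianBounds H R K := by
  set f : Rd d × Rd d → ℝ := fun z => H z.1 z.2 with hf
  set S : Set (Rd d × Rd d) := univ ×ˢ Metric.closedBall 0 R with hS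
  have hconv : Convex ℝ S := convex_univ.prod (convex_closedBall _ _)
  have hf1 : ContDiff ℝ 2 (fderiv ℝ f) := hH.contDiff.fderiv_right (by norm_num)
  have hper : ∀ (z : Rd d × Rd d) (n : Fin d → ℤ), f (z + (latticeVec n, 0)) = f z := by
    intro z n
    simp only [hf, Prod.fst_add, Prod.snd_add, add_zero]
    exact hH.periodic z.2 z.1 n
  have hper1 : ∀ (z : Rd d × Rd d) (n : Fin d → ℤ),
      fderiv ℝ f (z + (latticeVec n, 0)) = fderiv ℝ f z := by
    intro z n
    rw [← fderiv_comp_add_right]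
    congr 1
    exact funext fun x => hper x n
  have hper2 : ∀ (z : Rd d × Rd d) (n : Fin d → ℤ),
      fderiv ℝ (fderiv ℝ f) (z + (latticeVec n, 0)) = fderiv ℝ (fderiv ℝ f) z := by
    intro z n
    rw [← fderiv_comp_add_right]
    congr 1
    exact funext fun x => hper1 x n
  obtain ⟨C₁, hC₁0, hC₁⟩ := exists_forall_norm_le_of_periodic (d := d)
    (isCompact_closedBall (0 : Rd d) R) (f := fun p q => fderiv ℝ f (q, p))
    (hf1.continuous.comp continuous_swap).continuousOn
    (fun p _ q n => by simpa using hper1 (q, p) n)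
  obtain ⟨C₂, hC₂0, hC₂⟩ := exists_forall_norm_le_of_periodic (d := d)
    (isCompact_closedBall (0 : Rd d) R) (f := fun p q => ‖fderiv ℝ (fderiv ℝ f) (q, p)‖)
    ((hf1.continuous_fderiv (by norm_num)).norm.comp continuous_swap).continuousOn
    (fun p _ q n => congrArg norm (by simpa using hper2 (q, p) n))
  have hlip : ∀ z ∈ S, ∀ z' ∈ S, ‖fderiv ℝ f z - fderiv ℝ f z'‖ ≤ C₂ * ‖z - z'‖ :=
    fun z hz z' hz' => Convex.norm_image_sub_le_of_norm_fderiv_le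
      (fun x _ => hf1.differentiable (by norm_num) x)
      (fun x hx => (le_abs_self _).trans (hC₂ x.2 hx.2 x.1)) hconv hz' hz
  have hmem : ∀ q p : Rd d, ‖p‖ ≤ R → (q, p) ∈ S := fun q p hp => ⟨mem_univ _, by simpa using hp⟩
  have hnorm : ∀ v w : Rd d, ‖(v, w)‖ ≤ ‖v‖ + ‖w‖ := fun v w =>
    max_le (le_add_of_nonneg_right (norm_nonneg w)) (le_add_of_nonneg_left (norm_nonneg v))
  have hinl : ∀ A : Rd d × Rd d →L[ℝ] ℝ,
      ‖A.comp (ContinuousLinearMap.inl ℝ (Rd d) (Rd d))‖ ≤ ‖A‖ := fun A =>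
    (A.opNorm_comp_le _).trans
      (mul_le_of_le_one_right (norm_nonneg _) (ContinuousLinearMap.norm_inl_le_one ℝ _ _))
  have hinr : ∀ A : Rd d × Rd d →L[ℝ] ℝ,
      ‖A.comp (ContinuousLinearMap.inr ℝ (Rd d) (Rd d))‖ ≤ ‖A‖ := fun A =>
    (A.opNorm_comp_le _).trans
      (mul_le_of_le_one_right (norm_nonneg _) (ContinuousLinearMap.norm_inr_le_one ℝ _ _))
  have hmax₁ : C₁ ≤ max C₁ C₂ := le_max_left _ _
  have hmax₂ : C₂ ≤ max C₁ C₂ := le_max_right _ _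
  refine ⟨max C₁ C₂, ⟨fun q p hp => ?_, fun q p hp => ?_, fun q q' p p' hp hp' => ?_,
    fun q q' p p' hp hp' => ?_, fun q q' p p' hp hp' => ?_⟩⟩
  · rw [hH.gradHq_eq, LinearIsometryEquiv.norm_map]
    exact (hinl _).trans ((hC₁ p (by simpa using hp) q).trans hmax₁)
  · rw [hH.gradHp_eq, LinearIsometryEquiv.norm_map]
    exact (hinr _).trans ((hC₁ p (by simpa using hp) q).trans hmax₁)
  · rw [hH.gradHq_eq, hH.gradHq_eq, ← map_sub, LinearIsometryEquiv.norm_map,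
      ← ContinuousLinearMap.sub_comp]
    refine (hinl _).trans ((hlip _ (hmem q p hp) _ (hmem q' p' hp')).trans ?_)
    exact mul_le_mul hmax₂ (hnorm (q - q') (p - p')) (norm_nonneg _) (hC₂0.trans hmax₂)
  · rw [hH.gradHp_eq, hH.gradHp_eq, ← map_sub, LinearIsometryEquiv.norm_map,
      ← ContinuousLinearMap.sub_comp]
    refine (hinr _).trans ((hlip _ (hmem q p hp) _ (hmem q' p' hp')).trans ?_)
    exact mul_le_mul hmax₂ (hnorm (q - q') (p - p')) (norm_nonneg _) (hC₂0.trans hmax₂)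
  · have hseg : segment ℝ (q, p) (q', p') ⊆ S :=
      hconv.segment_subset (hmem q p hp) (hmem q' p' hp')
    have h := Convex.norm_image_sub_le_of_norm_hasFDerivWithin_le' (f := f)
      (s := segment ℝ (q, p) (q', p')) (φ := fderiv ℝ f (q, p)) (C := C₂ * ‖(q', p') - (q, p)‖)
      (fun x _ => (hH.hasFDerivAt x).hasFDerivWithinAt)
      (fun x hx => (hlip x (hseg hx) _ (hmem q p hp)).trans
        (mul_le_mul_of_nonneg_left (norm_sub_le_of_mem_segment hx) hC₂0))
      (convex_segment _ _) (left_mem_segment ℝ _ _) (right_mem_segment ℝ _ _)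
    rw [Prod.mk_sub_mk, hH.fderiv_apply, Real.norm_eq_abs, ← sub_sub, mul_assoc, ← sq] at h
    refine h.trans ?_
    exact mul_le_mul hmax₂ (pow_le_pow_left₀ (norm_nonneg _) (hnorm _ _) 2)
      (sq_nonneg _) (hC₂0.trans hmax₂)

end IsHamiltonian

/-! ### A two-point boundary value problem in Banach spaces -/

/-- The first component is prescribed at time `s`, the second at time `0` as a function of the
first. On a short interval the integral form of the problem is a contraction of the space of
continuous curves. -/
theorem exists_solution_boundary_problem {X Y : Type*} [NormedAddCommGroup X] [NormedSpace ℝ X]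
    [CompleteSpace X] [NormedAddCommGroup Y] [NormedSpace ℝ Y] [CompleteSpace Y]
    {V₁ : X × Y → X} {V₂ : X × Y → Y} {G : X → Y} {Λ T s : ℝ} (hΛ : 1 ≤ Λ)
    (hV₁ : ∀ z z', ‖V₁ z - V₁ z'‖ ≤ Λ * ‖z - z'‖) (hV₂ : ∀ z z', ‖V₂ z - V₂ z'‖ ≤ Λ * ‖z - z'‖)
    (hG : ∀ x x', ‖G x - G x'‖ ≤ Λ * ‖x - x'‖) (hT : 0 < T) (hTΛ : 8 * Λ ^ 2 * T ≤ 1)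
    (hs : s ∈ Icc 0 T) :
    ∃ (x : ℝ → X) (y : ℝ → Y), Continuous x ∧ Continuous y ∧
      (∀ t ∈ Icc 0 T, HasDerivAt x (V₁ (x t, y t)) t) ∧
      (∀ t ∈ Icc 0 T, HasDerivAt y (V₂ (x t, y t)) t) ∧ x s = 0 ∧ y 0 = G (x 0) := by
  have hΛ0 : 0 ≤ Λ := zero_le_one.trans hΛ
  have hcV₁ : Continuous V₁ := (LipschitzWith.of_dist_le_mul (K := ⟨Λ, hΛ0⟩)
    (fun z z' => by rw [dist_eq_norm, dist_eq_norm]; exact hV₁ z z')).continuous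
  have hcV₂ : Continuous V₂ := (LipschitzWith.of_dist_le_mul (K := ⟨Λ, hΛ0⟩)
    (fun z z' => by rw [dist_eq_norm, dist_eq_norm]; exact hV₂ z z')).continuous
  -- curves are extended to all times by constants, so that the integrands are continuous on `ℝ`
  let ext : C(Icc 0 T, X × Y) → ℝ → X × Y := fun c τ => c (projIcc 0 T hT.le τ)
  have hext : ∀ c, Continuous (ext c) := fun c => c.continuous.comp continuous_projIcc
  have hext_sub : ∀ c c' τ, ‖ext c τ - ext c' τ‖ ≤ dist c c' := fun c c' τ => by
    rw [← dist_eq_norm]; exact ContinuousMap.dist_apply_le_dist _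
  let x : C(Icc 0 T, X × Y) → ℝ → X := fun c t => ∫ τ in s..t, V₁ (ext c τ)
  let y : C(Icc 0 T, X × Y) → ℝ → Y := fun c t => G (x c 0) + ∫ τ in (0 : ℝ)..t, V₂ (ext c τ)
  have hdx : ∀ c t, HasDerivAt (x c) (V₁ (ext c t)) t := fun c t =>
    ((hcV₁.comp (hext c)).integral_hasStrictDerivAt s t).hasDerivAt
  have hdy : ∀ c t, HasDerivAt (y c) (V₂ (ext c t)) t := fun c t =>
    ((hcV₂.comp (hext c)).integral_hasStrictDerivAt 0 t).hasDerivAt.const_add _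
  have hcx : ∀ c, Continuous (x c) := fun c =>
    continuous_iff_continuousAt.2 fun t => (hdx c t).continuousAt
  have hcy : ∀ c, Continuous (y c) := fun c =>
    continuous_iff_continuousAt.2 fun t => (hdy c t).continuousAt
  let Φ : C(Icc 0 T, X × Y) → C(Icc 0 T, X × Y) := fun c =>
    ⟨fun t => (x c t, y c t), ((hcx c).comp continuous_subtype_val).prodMk
      ((hcy c).comp continuous_subtype_val)⟩
  have habs : ∀ a ∈ Icc 0 T, ∀ b ∈ Icc 0 T, |b - a| ≤ T := fun a ha b hb =>
    abs_sub_le_iff.2 ⟨by linarith [ha.1, hb.2], by linarith [hb.1, ha.2]⟩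
  have hx_sub : ∀ c c', ∀ t ∈ Icc 0 T, ‖x c t - x c' t‖ ≤ Λ * dist c c' * T := by
    intro c c' t ht
    have h : x c t - x c' t = ∫ τ in s..t, (V₁ (ext c τ) - V₁ (ext c' τ)) :=
      (intervalIntegral.integral_sub ((hcV₁.comp (hext c)).intervalIntegrable _ _)
        ((hcV₁.comp (hext c')).intervalIntegrable _ _)).symm
    rw [h]
    refine (intervalIntegral.norm_integral_le_of_norm_le_const (C := Λ * dist c c')
      fun τ _ => (hV₁ _ _).trans ?_).trans ?_
    · exact mul_le_mul_of_nonneg_left (hext_sub _ _ _) hΛ0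
    · exact mul_le_mul_of_nonneg_left (habs s hs t ht) (by positivity)
  have hy_sub : ∀ c c', ∀ t ∈ Icc 0 T, ‖y c t - y c' t‖ ≤
      Λ * (Λ * dist c c' * T) + Λ * dist c c' * T := by
    intro c c' t ht
    have h : y c t - y c' t = (G (x c 0) - G (x c' 0))
        + ∫ τ in (0 : ℝ)..t, (V₂ (ext c τ) - V₂ (ext c' τ)) := by
      have h' : ∫ τ in (0 : ℝ)..t, (V₂ (ext c τ) - V₂ (ext c' τ)) =
          (∫ τ in (0 : ℝ)..t, V₂ (ext c τ)) - ∫ τ in (0 : ℝ)..t, V₂ (ext c' τ) :=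
        intervalIntegral.integral_sub ((hcV₂.comp (hext c)).intervalIntegrable _ _)
          ((hcV₂.comp (hext c')).intervalIntegrable _ _)
      rw [h']
      simp only [y]
      abel
    rw [h]
    refine (norm_add_le _ _).trans (add_le_add ?_ ?_)
    · exact (hG _ _).trans
        (mul_le_mul_of_nonneg_left (hx_sub c c' 0 (left_mem_Icc.2 hT.le)) hΛ0)
    · refine (intervalIntegral.norm_integral_le_of_norm_le_const (C := Λ * dist c c')
        fun τ _ => (hV₂ _ _).trans ?_).trans ?_
      · exact mul_le_mul_of_nonneg_left (hext_sub _ _ _) hΛ0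
      · exact mul_le_mul_of_nonneg_left (habs 0 (left_mem_Icc.2 hT.le) t ht) (by positivity)
  have hsmall : ∀ D : ℝ, 0 ≤ D → Λ * D * T ≤ D / 8 ∧ Λ * (Λ * D * T) ≤ D / 8 := by
    intro D hD
    have h1 : Λ * T ≤ Λ ^ 2 * T := by nlinarith [mul_nonneg hΛ0 hT.le]
    constructor <;> nlinarith [mul_le_mul_of_nonneg_left hTΛ hD, mul_le_mul_of_nonneg_left h1 hD]
  have hΦ : ContractingWith (1 / 2) Φ := by
    refine ⟨by rw [← NNReal.coe_lt_coe]; norm_num, LipschitzWith.of_dist_le_mul fun c c' => ?_⟩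
    have hD : 0 ≤ dist c c' := dist_nonneg
    obtain ⟨h1, h2⟩ := hsmall _ hD
    refine (ContinuousMap.dist_le (by positivity)).2 fun t => ?_
    rw [dist_eq_norm]
    refine max_le ?_ ?_
    · exact (hx_sub c c' t t.2).trans (by norm_num; linarith)
    · exact (hy_sub c c' t t.2).trans (by norm_num; linarith)
  obtain ⟨c, hc⟩ : ∃ c, Φ c = c := ⟨_, hΦ.fixedPoint_isFixedPt⟩
  have hfix : ∀ t ∈ Icc 0 T, ext c t = (x c t, y c t) := by
    intro t ht
    have h : ext c t = c ⟨t, ht⟩ := by simp only [ext, projIcc_of_mem hT.le ht]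
    rw [h]
    exact (DFunLike.congr_fun hc ⟨t, ht⟩).symm
  refine ⟨x c, y c, hcx c, hcy c, fun t ht => ?_, fun t ht => ?_, ?_, ?_⟩
  · rw [← hfix t ht]; exact hdx c t
  · rw [← hfix t ht]; exact hdy c t
  · exact intervalIntegral.integral_same
  · simp [y]

/-! ### Characteristic curves with a prescribed path of measures -/

/-- The coefficients are admissible with constant `K`, and the horizon `T` is short compared with
`K`. The slack `2` in the radius leaves room for a cutoff of the momenta, and `128` is what the
contraction argument for the existence of the flow asks for. -/
structure IsShortTime (H : Rd d → Rd d → ℝ) (F g : Rd d → ProbabilityMeasure (Rd d) → ℝ)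
    (κ K T : ℝ) : Prop where
  hamiltonian : IsHamiltonian H
  coupling : IsCoupling κ F
  initialCoupling : IsCoupling κ g
  bounds : HamiltonianBounds H (κ + 2) K
  κ_nonneg : 0 ≤ κ
  one_le : 1 ≤ K
  κ_le : κ ≤ K
  T_pos : 0 < T
  T_small : 128 * K ^ 2 * T ≤ 1

/-- `(x, p)` is the characteristic through `q` at time `s` of the system in which the path of
measures is frozen to `σ`. -/
structure IsCharCurve (H : Rd d → Rd d → ℝ) (F g : Rd d → ProbabilityMeasure (Rd d) → ℝ)
    (T s : ℝ) (σ : ℝ → ProbabilityMeasure (Rd d)) (q : Rd d) (x p : ℝ → Rd d) : Prop where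
  deriv_x : ∀ t ∈ Icc 0 T, HasDerivWithinAt x (gradHp H (x t) (p t)) (Icc 0 T) t
  deriv_p : ∀ t ∈ Icc 0 T,
    HasDerivWithinAt p (-gradHq H (x t) (p t) - gradq F (x t) (σ t)) (Icc 0 T) t
  terminal : x s = q
  initial : p 0 = gradq g (x 0) (σ 0)

/-- The mean value inequality on `[0,T]`, between two arbitrary times. -/
lemma norm_sub_le_of_hasDerivWithinAt {E : Type*} [NormedAddCommGroup E] [NormedSpace ℝ E]
    {f f' : ℝ → E} {T C : ℝ} (hf : ∀ t ∈ Icc 0 T, HasDerivWithinAt f (f' t) (Icc 0 T) t)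
    (hC : ∀ t ∈ Icc 0 T, ‖f' t‖ ≤ C) {t t' : ℝ} (ht : t ∈ Icc 0 T) (ht' : t' ∈ Icc 0 T) :
    ‖f t - f t'‖ ≤ C * |t - t'| :=
  (convex_Icc 0 T).norm_image_sub_le_of_norm_hasDerivWithin_le hf hC ht' ht

lemma abs_sub_le_of_mem_Icc {T a b : ℝ} (ha : a ∈ Icc 0 T) (hb : b ∈ Icc 0 T) : |a - b| ≤ T :=
  abs_sub_le_iff.2 ⟨by linarith [ha.2, hb.1], by linarith [hb.2, ha.1]⟩

namespace IsShortTime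

variable {H : Rd d → Rd d → ℝ} {F g : Rd d → ProbabilityMeasure (Rd d) → ℝ} {κ K T s : ℝ}
  {σ σ₁ σ₂ : ℝ → ProbabilityMeasure (Rd d)} {q q₁ q₂ : Rd d} {x p x₁ p₁ x₂ p₂ : ℝ → Rd d}

lemma K_nonneg (h : IsShortTime H F g κ K T) : 0 ≤ K := zero_le_one.trans h.one_le

lemma K_T_small (h : IsShortTime H F g κ K T) : 128 * K * T ≤ 1 := by
  have h1 := h.one_le
  have h2 := h.T_small
  have h3 : K * T ≤ K ^ 2 * T := by nlinarith [mul_nonneg h.K_nonneg h.T_pos.le]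
  linarith

/-- Before the momentum leaves the ball of radius `κ + 1`, its speed is at most `K + κ`; on a short
interval it therefore cannot leave it. -/
lemma norm_momentum_le (h : IsShortTime H F g κ K T) (hc : IsCharCurve H F g T s σ q x p) :
    ∀ t ∈ Icc 0 T, ‖p t‖ ≤ κ + 1 := by
  have hK := h.one_le
  have hκ := h.κ_le
  have hκ0 := h.κ_nonneg
  have hKT := h.K_T_small
  have hB : ∀ t ∈ Icc 0 T, κ + (K + κ + 1) * t ≤ κ + 1 := by
    intro t ht
    have h1 : (K + κ + 1) * t ≤ (3 * K) * T :=
      mul_le_mul (by linarith) ht.2 ht.1 (by linarith)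
    nlinarith [mul_nonneg h.K_nonneg h.T_pos.le]
  intro t ht
  refine le_trans ?_ (hB t ht)
  refine image_norm_le_of_norm_deriv_right_lt_deriv_boundary (a := 0) (b := T) (f := p)
    (f' := fun t => -gradHq H (x t) (p t) - gradq F (x t) (σ t))
    (B := fun t => κ + (K + κ + 1) * t) (B' := fun _ => K + κ + 1)
    (fun t ht => (hc.deriv_p t ht).continuousWithinAt) (fun t ht => ?_) ?_ (fun t => ?_)
    (fun t ht heq => ?_) ht
  · exact (hc.deriv_p t (Ico_subset_Icc_self ht)).mono_of_mem_nhdsWithin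
      (Icc_mem_nhdsGE_of_mem ht)
  · simp only [mul_zero, add_zero, hc.initial]
    exact h.initialCoupling.norm_gradq_le _ _
  · simpa using ((hasDerivAt_id t).const_mul (K + κ + 1)).const_add κ
  · have hp : ‖p t‖ ≤ κ + 2 := by
      rw [heq]; linarith [hB t (Ico_subset_Icc_self ht)]
    calc ‖-gradHq H (x t) (p t) - gradq F (x t) (σ t)‖
        ≤ ‖gradHq H (x t) (p t)‖ + ‖gradq F (x t) (σ t)‖ := by
          rw [← norm_neg (gradHq H (x t) (p t))]; exact norm_sub_le _ _
      _ ≤ K + κ := add_le_add (h.bounds.norm_gradHq_le _ _ hp) (h.coupling.norm_gradq_le _ _)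
      _ < K + κ + 1 := by linarith

lemma norm_momentum_le' (h : IsShortTime H F g κ K T) (hc : IsCharCurve H F g T s σ q x p) :
    ∀ t ∈ Icc 0 T, ‖p t‖ ≤ κ + 2 := fun t ht => by
  linarith [h.norm_momentum_le hc t ht]

lemma norm_curve_sub_le (h : IsShortTime H F g κ K T) (hc : IsCharCurve H F g T s σ q x p)
    {t t' : ℝ} (ht : t ∈ Icc 0 T) (ht' : t' ∈ Icc 0 T) : ‖x t - x t'‖ ≤ K * |t - t'| :=
  norm_sub_le_of_hasDerivWithinAt hc.deriv_x
    (fun t ht => h.bounds.norm_gradHp_le _ _ (h.norm_momentum_le' hc t ht)) ht ht'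

lemma norm_momentum_sub_le (h : IsShortTime H F g κ K T) (hc : IsCharCurve H F g T s σ q x p)
    {t t' : ℝ} (ht : t ∈ Icc 0 T) (ht' : t' ∈ Icc 0 T) : ‖p t - p t'‖ ≤ 2 * K * |t - t'| := by
  refine norm_sub_le_of_hasDerivWithinAt hc.deriv_p (fun t ht => ?_) ht ht'
  rw [← neg_add', norm_neg]
  have h1 := h.bounds.norm_gradHq_le (x t) (p t) (h.norm_momentum_le' hc t ht)
  have h2 := h.coupling.norm_gradq_le (x t) (σ t)
  linarith [norm_add_le (gradHq H (x t) (p t)) (gradq F (x t) (σ t)), h.κ_le]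

/-- The basic stability estimate: characteristics depend in a Lipschitz way on their terminal point
and on the path of measures, and over a short time the displacement hardly changes. -/
lemma stability (h : IsShortTime H F g κ K T) (hs : s ∈ Icc 0 T)
    (hc₁ : IsCharCurve H F g T s σ₁ q₁ x₁ p₁) (hc₂ : IsCharCurve H F g T s σ₂ q₂ x₂ p₂)
    {w : ℝ} (hw0 : 0 ≤ w) (hw : ∀ t ∈ Icc 0 T, torusW (σ₁ t) (σ₂ t) ≤ w) :
    ∀ t ∈ Icc 0 T, ‖x₁ t - x₂ t - (q₁ - q₂)‖ ≤ (‖q₁ - q₂‖ + w) / 2 ∧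
      ‖p₁ t - p₂ t‖ ≤ 4 * K * (‖q₁ - q₂‖ + w) := by
  have hT := h.T_pos
  have hK := h.one_le
  have hK0 := h.K_nonneg
  have h0 : (0 : ℝ) ∈ Icc 0 T := left_mem_Icc.2 hT.le
  have hκ0 := h.κ_nonneg
  have hcont : ContinuousOn (fun t => ‖x₁ t - x₂ t‖ + ‖p₁ t - p₂ t‖) (Icc 0 T) :=
    fun t ht => ((hc₁.deriv_x t ht).continuousWithinAt.sub
      (hc₂.deriv_x t ht).continuousWithinAt).norm.add
      ((hc₁.deriv_p t ht).continuousWithinAt.sub (hc₂.deriv_p t ht).continuousWithinAt).norm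
  obtain ⟨t₀, ht₀, hmax⟩ := isCompact_Icc.exists_isMaxOn ⟨0, h0⟩ hcont
  set S := ‖x₁ t₀ - x₂ t₀‖ + ‖p₁ t₀ - p₂ t₀‖ with hS
  have hS0 : 0 ≤ S := by positivity
  have hmax' : ∀ t ∈ Icc 0 T, ‖x₁ t - x₂ t‖ + ‖p₁ t - p₂ t‖ ≤ S := fun t ht => hmax ht
  have hx : ∀ t ∈ Icc 0 T, ‖x₁ t - x₂ t - (q₁ - q₂)‖ ≤ K * S * T := by
    intro t ht
    have h1 := norm_sub_le_of_hasDerivWithinAt (C := K * S)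
      (fun t ht => (hc₁.deriv_x t ht).sub (hc₂.deriv_x t ht))
      (fun t ht => (h.bounds.norm_gradHp_sub_le _ _ _ _ (h.norm_momentum_le' hc₁ t ht)
        (h.norm_momentum_le' hc₂ t ht)).trans (mul_le_mul_of_nonneg_left (hmax' t ht) hK0)) ht hs
    simp only [Pi.sub_apply, hc₁.terminal, hc₂.terminal] at h1
    exact h1.trans (mul_le_mul_of_nonneg_left (abs_sub_le_of_mem_Icc ht hs) (by positivity))
  have hx' : ∀ t ∈ Icc 0 T, ‖x₁ t - x₂ t‖ ≤ ‖q₁ - q₂‖ + K * S * T := by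
    intro t ht
    have := norm_sub_norm_le (x₁ t - x₂ t) (q₁ - q₂)
    linarith [hx t ht]
  have hp : ∀ t ∈ Icc 0 T, ‖p₁ t - p₂ t‖ ≤
      K * (‖q₁ - q₂‖ + K * S * T + w) + (2 * K * S + K * w) * T := by
    intro t ht
    have h1 := norm_sub_le_of_hasDerivWithinAt (C := 2 * K * S + K * w)
      (fun t ht => (hc₁.deriv_p t ht).sub (hc₂.deriv_p t ht))
      (fun t ht => by
        have e1 := h.bounds.norm_gradHq_sub_le (x₁ t) (x₂ t) (p₁ t) (p₂ t)
          (h.norm_momentum_le' hc₁ t ht) (h.norm_momentum_le' hc₂ t ht)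
        have e2 := h.coupling.norm_gradq_sub_le hκ0 (x₁ t) (x₂ t) (σ₁ t) (σ₂ t)
        have e3 : κ * (‖x₁ t - x₂ t‖ + torusW (σ₁ t) (σ₂ t)) ≤ K * (S + w) :=
          mul_le_mul h.κ_le (add_le_add ((le_add_of_nonneg_right (norm_nonneg _)).trans
            (hmax' t ht)) (hw t ht)) (add_nonneg (norm_nonneg _) (torusW_nonneg _ _)) hK0
        have e4 := mul_le_mul_of_nonneg_left (hmax' t ht) hK0
        have e5 := norm_add_le (gradHq H (x₁ t) (p₁ t) - gradHq H (x₂ t) (p₂ t))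
          (gradq F (x₁ t) (σ₁ t) - gradq F (x₂ t) (σ₂ t))
        have e6 : -gradHq H (x₁ t) (p₁ t) - gradq F (x₁ t) (σ₁ t)
            - (-gradHq H (x₂ t) (p₂ t) - gradq F (x₂ t) (σ₂ t))
            = -((gradHq H (x₁ t) (p₁ t) - gradHq H (x₂ t) (p₂ t))
              + (gradq F (x₁ t) (σ₁ t) - gradq F (x₂ t) (σ₂ t))) := by abel
        rw [e6, norm_neg]
        linarith) ht h0
    simp only [Pi.sub_apply, hc₁.initial, hc₂.initial, sub_zero] at h1
    have h2 : ‖gradq g (x₁ 0) (σ₁ 0) - gradq g (x₂ 0) (σ₂ 0)‖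
        ≤ K * (‖q₁ - q₂‖ + K * S * T + w) :=
      (h.initialCoupling.norm_gradq_sub_le hκ0 _ _ _ _).trans
        (mul_le_mul h.κ_le (add_le_add (hx' 0 h0) (hw 0 h0))
          (add_nonneg (norm_nonneg _) (torusW_nonneg _ _)) hK0)
    have h3 := norm_sub_norm_le (p₁ t - p₂ t) (gradq g (x₁ 0) (σ₁ 0) - gradq g (x₂ 0) (σ₂ 0))
    have h4 : (2 * K * S + K * w) * |t| ≤ (2 * K * S + K * w) * T :=
      mul_le_mul_of_nonneg_left (by rw [abs_of_nonneg ht.1]; exact ht.2) (by positivity)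
    linarith
  have hq0 := norm_nonneg (q₁ - q₂)
  have hKT : K * T ≤ 1 / 128 := by linarith [h.K_T_small]
  have hKKT : K * (K * T) ≤ 1 / 128 := by linarith [h.T_small]
  have a1 : K * S * T ≤ S / 128 := by nlinarith
  have a2 : K * (K * S * T) ≤ S / 128 := by nlinarith
  have a3 : K * w * T ≤ w / 128 := by nlinarith
  have a4 : w ≤ K * w := le_mul_of_one_le_left hw0 hK
  have a5 : ‖q₁ - q₂‖ ≤ K * ‖q₁ - q₂‖ := le_mul_of_one_le_left hq0 hK
  have hSle : S ≤ 4 * K * (‖q₁ - q₂‖ + w) := by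
    have h1 := hx' t₀ ht₀
    have h2 := hp t₀ ht₀
    nlinarith
  intro t ht
  refine ⟨(hx t ht).trans ?_, ?_⟩
  · have b1 : K * S * T ≤ K * (4 * K * (‖q₁ - q₂‖ + w)) * T := by gcongr
    nlinarith
  · exact ((le_add_of_nonneg_left (norm_nonneg _)).trans (hmax' t ht)).trans hSle

end IsShortTime

/-! ### The characteristic flow: Lipschitz estimates, periodicity, uniqueness -/

/-- The Hamiltonian system of characteristics without the periodicity of its solutions, which turns
out to be automatic. -/
structure IsCharSystem (H : Rd d → Rd d → ℝ) (F g : Rd d → ProbabilityMeasure (Rd d) → ℝ)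
    (T s : ℝ) (μ : ProbabilityMeasure (Rd d)) (Q P : ℝ → Rd d → Rd d) : Prop where
  continuous_Q : ContinuousOn (fun z : ℝ × Rd d => Q z.1 z.2) (Icc 0 T ×ˢ univ)
  continuous_P : ContinuousOn (fun z : ℝ × Rd d => P z.1 z.2) (Icc 0 T ×ˢ univ)
  curve : ∀ q, IsCharCurve H F g T s (fun t => pushforward (Q t) μ) q (fun t => Q t q)
    (fun t => P t q)

lemma IsCharacteristicFlow.isCharSystem {H : Rd d → Rd d → ℝ}
    {F g : Rd d → ProbabilityMeasure (Rd d) → ℝ} {T s : ℝ} {μ : ProbabilityMeasure (Rd d)}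
    {Q P : ℝ → Rd d → Rd d} (h : IsCharacteristicFlow H F g T s μ Q P) :
    IsCharSystem H F g T s μ Q P where
  continuous_Q := h.continuous_Q
  continuous_P := h.continuous_P
  curve q :=
    { deriv_x := fun t ht => h.ode_Q t ht q
      deriv_p := fun t ht => h.ode_P t ht q
      terminal := h.terminal_Q q
      initial := h.initial_P q }

lemma IsCoupling.gradq_add_latticeVec {κ : ℝ} {F : Rd d → ProbabilityMeasure (Rd d) → ℝ}
    (hF : IsCoupling κ F) (q : Rd d) (μ : ProbabilityMeasure (Rd d)) (n : Fin d → ℤ) :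
    gradq F (q + latticeVec n) μ = gradq F q μ := by
  rw [gradq, gradq, gradient, gradient, ← fderiv_comp_add_right]
  congr 2
  exact funext fun x => hF.periodic μ x n

lemma IsCoupling.continuous_gradq {κ : ℝ} {F : Rd d → ProbabilityMeasure (Rd d) → ℝ}
    (hF : IsCoupling κ F) (μ : ProbabilityMeasure (Rd d)) : Continuous fun q => gradq F q μ :=
  (LinearIsometryEquiv.continuous _).comp ((hF.contDiff μ).continuous_fderiv (by norm_num))

lemma continuous_slice {E : Type*} [TopologicalSpace E] {f : ℝ → Rd d → E} {T t : ℝ}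
    (hf : ContinuousOn (fun z : ℝ × Rd d => f z.1 z.2) (Icc 0 T ×ˢ univ)) (ht : t ∈ Icc 0 T) :
    Continuous (f t) :=
  hf.comp_continuous (f := fun q => (t, q)) (by fun_prop) fun q => ⟨ht, mem_univ q⟩

namespace IsShortTime

variable {H : Rd d → Rd d → ℝ} {F g : Rd d → ProbabilityMeasure (Rd d) → ℝ} {κ K T s : ℝ}
  {μ : ProbabilityMeasure (Rd d)} {Q P Q' P' : ℝ → Rd d → Rd d}

lemma zero_mem (h : IsShortTime H F g κ K T) : (0 : ℝ) ∈ Icc 0 T := left_mem_Icc.2 h.T_pos.le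

lemma norm_flow_sub_sub_le (h : IsShortTime H F g κ K T) (hs : s ∈ Icc 0 T)
    (hc : IsCharSystem H F g T s μ Q P) {t : ℝ} (ht : t ∈ Icc 0 T) (q q' : Rd d) :
    ‖Q t q - Q t q' - (q - q')‖ ≤ ‖q - q'‖ / 2 ∧ ‖P t q - P t q'‖ ≤ 4 * K * ‖q - q'‖ := by
  simpa using h.stability hs (hc.curve q) (hc.curve q') le_rfl
    (fun _ _ => (torusW_self_eq_zero _).le) t ht

lemma norm_sub_le_two_mul (h : IsShortTime H F g κ K T) (hs : s ∈ Icc 0 T)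
    (hc : IsCharSystem H F g T s μ Q P) {t : ℝ} (ht : t ∈ Icc 0 T) (q q' : Rd d) :
    ‖q - q'‖ ≤ 2 * ‖Q t q - Q t q'‖ := by
  have h1 := (h.norm_flow_sub_sub_le hs hc ht q q').1
  have h2 := norm_sub_norm_le (q - q') (Q t q - Q t q')
  rw [norm_sub_rev] at h1
  linarith

lemma norm_flow_sub_le (h : IsShortTime H F g κ K T) (hs : s ∈ Icc 0 T)
    (hc : IsCharSystem H F g T s μ Q P) {t : ℝ} (ht : t ∈ Icc 0 T) (q q' : Rd d) :
    ‖Q t q - Q t q'‖ ≤ 2 * ‖q - q'‖ := by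
  have h1 := (h.norm_flow_sub_sub_le hs hc ht q q').1
  have h2 := norm_sub_norm_le (Q t q - Q t q') (q - q')
  linarith [norm_nonneg (q - q')]

/-- At each time the flow is a perturbation of the identity by a map of Lipschitz constant `1/2`. -/
lemma bijective (h : IsShortTime H F g κ K T) (hs : s ∈ Icc 0 T)
    (hc : IsCharSystem H F g T s μ Q P) {t : ℝ} (ht : t ∈ Icc 0 T) :
    Function.Bijective (Q t) := by
  refine ⟨fun q q' hqq' => ?_, fun y => ?_⟩
  · have h1 := h.norm_sub_le_two_mul hs hc ht q q'
    rw [hqq', sub_self, norm_zero, mul_zero] at h1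
    exact sub_eq_zero.1 (norm_le_zero_iff.1 h1)
  · have hcontr : ContractingWith (1 / 2) fun q => y - (Q t q - q) := by
      refine ⟨by rw [← NNReal.coe_lt_coe]; norm_num, LipschitzWith.of_dist_le_mul fun q q' => ?_⟩
      rw [dist_eq_norm, dist_eq_norm]
      have h1 := (h.norm_flow_sub_sub_le hs hc ht q' q).1
      have h2 : y - (Q t q - q) - (y - (Q t q' - q')) = Q t q' - Q t q - (q' - q) := by abel
      rw [h2, norm_sub_rev q q']
      norm_num
      linarith
    have hfix : y - (Q t (hcontr.fixedPoint _) - hcontr.fixedPoint _) = hcontr.fixedPoint _ :=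
      hcontr.fixedPoint_isFixedPt
    refine ⟨hcontr.fixedPoint _, ?_⟩
    rw [sub_sub_eq_add_sub, sub_eq_iff_eq_add, add_comm] at hfix
    exact (add_left_cancel hfix).symm

lemma isCharCurve_add_latticeVec (h : IsShortTime H F g κ K T)
    {σ : ℝ → ProbabilityMeasure (Rd d)} {q : Rd d} {x p : ℝ → Rd d}
    (hc : IsCharCurve H F g T s σ q x p) (n : Fin d → ℤ) :
    IsCharCurve H F g T s σ (q + latticeVec n) (fun t => x t + latticeVec n) p where
  deriv_x _ ht := by
    rw [h.hamiltonian.gradHp_add_latticeVec]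
    exact (hc.deriv_x _ ht).add_const _
  deriv_p _ ht := by
    rw [h.hamiltonian.gradHq_add_latticeVec, h.coupling.gradq_add_latticeVec]
    exact hc.deriv_p _ ht
  terminal := by rw [hc.terminal]
  initial := by rw [h.initialCoupling.gradq_add_latticeVec, hc.initial]

/-- A translate of a characteristic is the characteristic through the translated point. -/
lemma flow_add_latticeVec (h : IsShortTime H F g κ K T) (hs : s ∈ Icc 0 T)
    (hc : IsCharSystem H F g T s μ Q P) {t : ℝ} (ht : t ∈ Icc 0 T) (q : Rd d) (n : Fin d → ℤ) :
    Q t (q + latticeVec n) = Q t q + latticeVec n ∧ P t (q + latticeVec n) = P t q := by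
  obtain ⟨h1, h2⟩ := h.stability hs (hc.curve (q + latticeVec n))
    (h.isCharCurve_add_latticeVec (hc.curve q) n) le_rfl
    (fun _ _ => (torusW_self_eq_zero _).le) t ht
  simp only [sub_self, norm_zero, add_zero, zero_div, mul_zero, norm_le_zero_iff, sub_zero,
    sub_eq_zero] at h1 h2
  exact ⟨h1, h2⟩

lemma isCharacteristicFlow (h : IsShortTime H F g κ K T) (hs : s ∈ Icc 0 T)
    (hc : IsCharSystem H F g T s μ Q P) : IsCharacteristicFlow H F g T s μ Q P where
  continuous_Q := hc.continuous_Q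
  continuous_P := hc.continuous_P
  torusMap_Q _ ht q n := ⟨n, (h.flow_add_latticeVec hs hc ht q n).1⟩
  periodic_P _ ht q n := (h.flow_add_latticeVec hs hc ht q n).2
  ode_Q t ht q := (hc.curve q).deriv_x t ht
  ode_P t ht q := (hc.curve q).deriv_p t ht
  terminal_Q q := (hc.curve q).terminal
  initial_P q := (hc.curve q).initial

lemma torusW_flow_le (h : IsShortTime H F g κ K T) (hc : IsCharSystem H F g T s μ Q P)
    {t t' : ℝ} (ht : t ∈ Icc 0 T) (ht' : t' ∈ Icc 0 T) :
    torusW (pushforward (Q t) μ) (pushforward (Q t') μ) ≤ K * |t - t'| :=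
  torusW_pushforward_le (continuous_slice hc.continuous_Q ht) (continuous_slice hc.continuous_Q ht')
    μ (mul_nonneg h.K_nonneg (abs_nonneg _)) fun q => h.norm_curve_sub_le (hc.curve q) ht ht'

/-- Stability halves every bound on the distance of two flows, since the paths of measures are no
further apart than the flows. -/
lemma flow_unique (h : IsShortTime H F g κ K T) (hs : s ∈ Icc 0 T)
    (hc : IsCharSystem H F g T s μ Q P) (hc' : IsCharSystem H F g T s μ Q' P') {t : ℝ}
    (ht : t ∈ Icc 0 T) : Q' t = Q t ∧ P' t = P t := by
  have hstep : ∀ w : ℝ, 0 ≤ w → (∀ t ∈ Icc 0 T, ∀ q, ‖Q' t q - Q t q‖ ≤ w) →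
      ∀ t ∈ Icc 0 T, ∀ q, ‖Q' t q - Q t q‖ ≤ w / 2 ∧ ‖P' t q - P t q‖ ≤ 4 * K * w := by
    intro w hw0 hw t ht q
    have h1 := h.stability hs (hc'.curve q) (hc.curve q) hw0
      (fun t ht => torusW_pushforward_le (continuous_slice hc'.continuous_Q ht)
        (continuous_slice hc.continuous_Q ht) μ hw0 (hw t ht)) t ht
    simpa using h1
  have hiter : ∀ n : ℕ, ∀ t ∈ Icc 0 T, ∀ q, ‖Q' t q - Q t q‖ ≤ 2 * K * T * (1 / 2) ^ n := by
    intro n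
    induction n with
    | zero =>
      intro t ht q
      have h1 := h.norm_curve_sub_le (hc.curve q) ht hs
      have h2 := h.norm_curve_sub_le (hc'.curve q) ht hs
      have h3 := mul_le_mul_of_nonneg_left (abs_sub_le_of_mem_Icc ht hs) h.K_nonneg
      simp only [(hc.curve q).terminal, (hc'.curve q).terminal] at h1 h2
      have h4 := norm_sub_le (Q' t q - q) (Q t q - q)
      rw [sub_sub_sub_cancel_right] at h4
      rw [pow_zero, mul_one]
      linarith
    | succ n ih =>
      intro t ht q
      have h1 : 0 ≤ 2 * K * T * (1 / 2 : ℝ) ^ n := by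
        have := h.K_nonneg
        have := h.T_pos
        positivity
      refine (hstep _ h1 ih t ht q).1.trans (le_of_eq ?_)
      ring
  have hlim : Tendsto (fun n : ℕ => 2 * K * T * (1 / 2 : ℝ) ^ n) atTop (𝓝 0) := by
    simpa using (tendsto_pow_atTop_nhds_zero_of_lt_one (r := (1 / 2 : ℝ)) (by norm_num)
      (by norm_num)).const_mul (2 * K * T)
  have hzero : ∀ t ∈ Icc 0 T, ∀ q, ‖Q' t q - Q t q‖ ≤ 0 := fun t ht q =>
    ge_of_tendsto' hlim fun n => hiter n t ht q
  refine ⟨funext fun q => sub_eq_zero.1 (norm_le_zero_iff.1 (hzero t ht q)),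
    funext fun q => sub_eq_zero.1 (norm_le_zero_iff.1 ?_)⟩
  simpa using (hstep 0 le_rfl hzero t ht q).2

end IsShortTime

/-! ### Existence of the characteristic flow -/

/-- A smooth map that is the identity on a ball and takes values in a larger one. -/
lemma exists_truncation {R : ℝ} (hR : 0 < R) :
    ∃ (r : Rd d → Rd d) (C : ℝ), (∀ p, ‖p‖ ≤ R → r p = p) ∧ (∀ p, ‖r p‖ ≤ R + 1) ∧
      ∀ p p', ‖r p - r p'‖ ≤ C * ‖p - p'‖ := by
  let b : ContDiffBump (0 : Rd d) := ⟨R, R + 1, hR, by linarith⟩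
  have hsmooth : ContDiff ℝ 1 fun p : Rd d => b p • p := b.contDiff.smul contDiff_id
  have hsupp : HasCompactSupport fun p : Rd d => b p • p := b.hasCompactSupport.smul_right
  obtain ⟨C, hC⟩ := hsmooth.lipschitzWith_of_hasCompactSupport hsupp (by norm_num)
  refine ⟨fun p => b p • p, C, fun p hp => ?_, fun p => ?_, fun p p' => ?_⟩
  · change b p • p = p
    rw [b.one_of_mem_closedBall (by simpa using hp), one_smul]
  · rw [norm_smul, Real.norm_of_nonneg b.nonneg]
    by_cases hp : ‖p‖ < R + 1
    · exact (mul_le_of_le_one_left (norm_nonneg _) b.le_one).trans hp.le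
    · rw [b.zero_of_le_dist (by simpa using hp), zero_mul]
      linarith
  · simpa [dist_eq_norm] using hC.dist_le_mul p p'

namespace IsShortTime

variable {H : Rd d → Rd d → ℝ} {F g : Rd d → ProbabilityMeasure (Rd d) → ℝ} {κ K T s : ℝ}

open BoundedContinuousFunction in
/-- The displacement and the momentum form a curve in the space of bounded continuous maps, on which
the truncated system is an ordinary differential equation with Lipschitz right-hand side. By the
bound on the momentum the truncation has no effect. -/
theorem exists_isCharSystem (h : IsShortTime H F g κ K T) (hs : s ∈ Icc 0 T)
    (μ : ProbabilityMeasure (Rd d)) {r : Rd d → Rd d} (hrc : Continuous r)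
    (hr : ∀ p, ‖p‖ ≤ κ + 1 → r p = p) (hrR : ∀ p, ‖r p‖ ≤ κ + 2)
    (hlipq : ∀ q q' p p', ‖gradHq H q (r p) - gradHq H q' (r p')‖ ≤ K * (‖q - q'‖ + ‖p - p'‖))
    (hlipp : ∀ q q' p p', ‖gradHp H q (r p) - gradHp H q' (r p')‖ ≤ K * (‖q - q'‖ + ‖p - p'‖)) :
    ∃ Q P : ℝ → Rd d → Rd d, IsCharSystem H F g T s μ Q P := by
  have hK0 := h.K_nonneg
  have hK1 := h.one_le
  have hκ0 := h.κ_nonneg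
  have hκK := h.κ_le
  -- the unknown is the pair of the displacement `q ↦ Q t q - q` and the momentum `q ↦ P t q`
  let E := Rd d →ᵇ Rd d
  let σ : E → ProbabilityMeasure (Rd d) := fun u => pushforward (fun q => q + u q) μ
  have hcont : ∀ u : E, Continuous fun q => q + u q := fun u => continuous_id.add u.continuous
  have hσ : ∀ u u' : E, torusW (σ u) (σ u') ≤ ‖u - u'‖ := fun u u' =>
    torusW_pushforward_le (hcont u) (hcont u') μ (norm_nonneg _) fun q => by
      rw [add_sub_add_left_eq_sub]; exact (u - u').norm_coe_le_norm q
  let V₁ : E × E → E := fun z => .ofNormedAddCommGroup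
    (fun q => gradHp H (q + z.1 q) (r (z.2 q)))
    (h.hamiltonian.continuous_gradHp.comp ((hcont z.1).prodMk (hrc.comp z.2.continuous))) K
    (fun q => h.bounds.norm_gradHp_le _ _ (hrR _))
  have hVbound : ∀ (q p : Rd d) ν, ‖-gradHq H q (r p) - gradq F q ν‖ ≤ 2 * K := by
    intro q p ν
    have h1 := h.bounds.norm_gradHq_le q (r p) (hrR p)
    have h2 := h.coupling.norm_gradq_le q ν
    have h3 := norm_sub_le (-gradHq H q (r p)) (gradq F q ν)
    rw [norm_neg] at h3
    linarith
  let V₂ : E × E → E := fun z => .ofNormedAddCommGroup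
    (fun q => -gradHq H (q + z.1 q) (r (z.2 q)) - gradq F (q + z.1 q) (σ z.1))
    ((h.hamiltonian.continuous_gradHq.comp
      ((hcont z.1).prodMk (hrc.comp z.2.continuous))).neg.sub
      ((h.coupling.continuous_gradq _).comp (hcont z.1))) (2 * K)
    (fun q => hVbound _ _ _)
  let G : E → E := fun u => .ofNormedAddCommGroup (fun q => gradq g (q + u q) (σ u))
    ((h.initialCoupling.continuous_gradq _).comp (hcont u)) κ
    (fun q => h.initialCoupling.norm_gradq_le _ _)
  have hsub : ∀ (u u' : E) q, ‖q + u q - (q + u' q)‖ ≤ ‖u - u'‖ := fun u u' q => by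
    rw [add_sub_add_left_eq_sub]; exact (u - u').norm_coe_le_norm q
  have hfst : ∀ z z' : E × E, ‖z.1 - z'.1‖ ≤ ‖z - z'‖ := fun z z' => norm_fst_le (z - z')
  have hsnd : ∀ z z' : E × E, ‖z.2 - z'.2‖ ≤ ‖z - z'‖ := fun z z' => norm_snd_le (z - z')
  have hboth : ∀ (z z' : E × E) q, K * (‖q + z.1 q - (q + z'.1 q)‖ + ‖z.2 q - z'.2 q‖) ≤
      2 * K * ‖z - z'‖ := by
    intro z z' q
    have h1 := (hsub z.1 z'.1 q).trans (hfst z z')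
    have h2 : ‖z.2 q - z'.2 q‖ ≤ ‖z - z'‖ := ((z.2 - z'.2).norm_coe_le_norm q).trans (hsnd z z')
    nlinarith
  have hV₁ : ∀ z z', ‖V₁ z - V₁ z'‖ ≤ 4 * K * ‖z - z'‖ := by
    intro z z'
    refine (norm_le (by positivity)).2 fun q => ?_
    refine ((hlipp _ _ _ _).trans (hboth z z' q)).trans ?_
    nlinarith [mul_nonneg hK0 (norm_nonneg (z - z'))]
  have hV₂ : ∀ z z', ‖V₂ z - V₂ z'‖ ≤ 4 * K * ‖z - z'‖ := by
    intro z z'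
    refine (norm_le (by positivity)).2 fun q => ?_
    have e1 := (hlipq (q + z.1 q) (q + z'.1 q) (z.2 q) (z'.2 q)).trans (hboth z z' q)
    have e2 := h.coupling.norm_gradq_sub_le hκ0 (q + z.1 q) (q + z'.1 q) (σ z.1) (σ z'.1)
    have e3 : κ * (‖q + z.1 q - (q + z'.1 q)‖ + torusW (σ z.1) (σ z'.1)) ≤
        K * (‖z - z'‖ + ‖z - z'‖) :=
      mul_le_mul hκK (add_le_add ((hsub _ _ q).trans (hfst z z')) ((hσ _ _).trans (hfst z z')))
        (add_nonneg (norm_nonneg _) (torusW_nonneg _ _)) hK0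
    have e4 : (V₂ z - V₂ z') q =
        -((gradHq H (q + z.1 q) (r (z.2 q)) - gradHq H (q + z'.1 q) (r (z'.2 q)))
          + (gradq F (q + z.1 q) (σ z.1) - gradq F (q + z'.1 q) (σ z'.1))) := by
      change (-gradHq H (q + z.1 q) (r (z.2 q)) - gradq F (q + z.1 q) (σ z.1))
        - (-gradHq H (q + z'.1 q) (r (z'.2 q)) - gradq F (q + z'.1 q) (σ z'.1)) = _
      abel
    rw [e4, norm_neg]
    refine (norm_add_le _ _).trans ?_
    linarith
  have hG : ∀ u u', ‖G u - G u'‖ ≤ 4 * K * ‖u - u'‖ := by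
    intro u u'
    refine (norm_le (by positivity)).2 fun q => ?_
    refine (h.initialCoupling.norm_gradq_sub_le hκ0 (q + u q) (q + u' q) (σ u) (σ u')).trans ?_
    have e3 : κ * (‖q + u q - (q + u' q)‖ + torusW (σ u) (σ u')) ≤
        K * (‖u - u'‖ + ‖u - u'‖) :=
      mul_le_mul hκK (add_le_add (hsub _ _ q) (hσ _ _))
        (add_nonneg (norm_nonneg _) (torusW_nonneg _ _)) hK0
    nlinarith [mul_nonneg hK0 (norm_nonneg (u - u'))]
  obtain ⟨x, y, hx, hy, hdx, hdy, hxs, hy0⟩ := exists_solution_boundary_problem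
    (by linarith : 1 ≤ 4 * K) hV₁ hV₂ hG h.T_pos (by linarith [h.T_small]) hs
  have hdx' : ∀ t ∈ Icc 0 T, ∀ q, HasDerivAt (fun t => x t q)
      (gradHp H (q + x t q) (r (y t q))) t := fun t ht q =>
    (evalCLM (α := Rd d) (β := Rd d) ℝ q).hasFDerivAt.comp_hasDerivAt t (hdx t ht)
  have hdy' : ∀ t ∈ Icc 0 T, ∀ q, HasDerivAt (fun t => y t q)
      (-gradHq H (q + x t q) (r (y t q)) - gradq F (q + x t q) (σ (x t))) t := fun t ht q =>
    (evalCLM (α := Rd d) (β := Rd d) ℝ q).hasFDerivAt.comp_hasDerivAt t (hdy t ht)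
  have hy0' : ∀ q, y 0 q = gradq g (q + x 0 q) (σ (x 0)) := fun q => by rw [hy0]; rfl
  have hry : ∀ t ∈ Icc 0 T, ∀ q, r (y t q) = y t q := by
    intro t ht q
    refine hr _ ?_
    have h1 := norm_sub_le_of_hasDerivWithinAt (fun t ht => (hdy' t ht q).hasDerivWithinAt)
      (fun t _ => hVbound _ _ _) ht h.zero_mem
    have h2 := h.initialCoupling.norm_gradq_le (q + x 0 q) (σ (x 0))
    have h3 := norm_sub_norm_le (y t q) (y 0 q)
    have h4 := mul_le_mul_of_nonneg_left (abs_sub_le_of_mem_Icc ht h.zero_mem)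
      (by positivity : 0 ≤ 2 * K)
    rw [← hy0'] at h2
    linarith [h.K_T_small, mul_nonneg hK0 h.T_pos.le]
  refine ⟨fun t q => q + x t q, fun t q => y t q, ?_, ?_, fun q => ⟨fun t ht => ?_, fun t ht => ?_,
    ?_, hy0' q⟩⟩
  · exact (continuous_snd.add ((hx.comp continuous_fst).eval continuous_snd)).continuousOn
  · exact ((hy.comp continuous_fst).eval continuous_snd).continuousOn
  · have h1 := ((hdx' t ht q).const_add q).hasDerivWithinAt (s := Icc 0 T)
    rwa [hry t ht q] at h1
  · have h1 := (hdy' t ht q).hasDerivWithinAt (s := Icc 0 T)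
    rwa [hry t ht q] at h1
  · rw [hxs]
    exact add_zero q

end IsShortTime

/-- The length of the time interval depends on the coefficients only. -/
theorem exists_short_time {H : Rd d → Rd d → ℝ} {F g : Rd d → ProbabilityMeasure (Rd d) → ℝ}
    {κ : ℝ} (hκ : 0 < κ) (hH : IsHamiltonian H) (hF : IsCoupling κ F) (hg : IsCoupling κ g) :
    ∃ K, ∃ T₀ > 0, ∀ T : ℝ, 0 < T → T ≤ T₀ → IsShortTime H F g κ K T ∧
      ∀ s ∈ Icc 0 T, ∀ μ : ProbabilityMeasure (Rd d),
        ∃ Q P : ℝ → Rd d → Rd d, IsCharSystem H F g T s μ Q P := by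
  obtain ⟨K₀, hK₀⟩ := hH.exists_bounds (κ + 2)
  obtain ⟨r, C, hr, hrR, hrC⟩ := exists_truncation (d := d) (R := κ + 1) (by linarith)
  have hrR' : ∀ p, ‖r p‖ ≤ κ + 2 := fun p => (hrR p).trans (by linarith)
  have hrc : Continuous r := by
    refine (LipschitzWith.of_dist_le_mul (K := C.toNNReal) fun p p' => ?_).continuous
    rw [dist_eq_norm, dist_eq_norm]
    exact (hrC p p').trans
      (mul_le_mul_of_nonneg_right (Real.le_coe_toNNReal C) (norm_nonneg _))
  set K := max (max 1 κ) (max K₀ (|K₀| * (1 + |C|))) with hK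
  have h1 : 1 ≤ K := (le_max_left _ _).trans (le_max_left _ _)
  have h2 : κ ≤ K := (le_max_right _ _).trans (le_max_left _ _)
  have h3 : K₀ ≤ K := (le_max_left _ _).trans (le_max_right _ _)
  have h4 : |K₀| * (1 + |C|) ≤ K := (le_max_right _ _).trans (le_max_right _ _)
  have hlip : ∀ q q' p p' : Rd d, K₀ * (‖q - q'‖ + ‖r p - r p'‖) ≤ K * (‖q - q'‖ + ‖p - p'‖) := by
    intro q q' p p'
    have e1 : ‖r p - r p'‖ ≤ |C| * ‖p - p'‖ :=
      (hrC p p').trans (mul_le_mul_of_nonneg_right (le_abs_self C) (norm_nonneg _))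
    have e2 : ‖q - q'‖ + ‖r p - r p'‖ ≤ (1 + |C|) * (‖q - q'‖ + ‖p - p'‖) := by
      nlinarith [mul_nonneg (abs_nonneg C) (norm_nonneg (q - q')), norm_nonneg (p - p')]
    calc K₀ * (‖q - q'‖ + ‖r p - r p'‖) ≤ |K₀| * ((1 + |C|) * (‖q - q'‖ + ‖p - p'‖)) :=
          mul_le_mul (le_abs_self _) e2 (by positivity) (abs_nonneg _)
      _ = |K₀| * (1 + |C|) * (‖q - q'‖ + ‖p - p'‖) := by ring
      _ ≤ K * (‖q - q'‖ + ‖p - p'‖) := mul_le_mul_of_nonneg_right h4 (by positivity)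
  refine ⟨K, 1 / (128 * K ^ 2), by positivity, fun T hT hT₀ => ?_⟩
  have hshort : IsShortTime H F g κ K T :=
    { hamiltonian := hH
      coupling := hF
      initialCoupling := hg
      bounds := hK₀.mono h3
      κ_nonneg := hκ.le
      one_le := h1
      κ_le := h2
      T_pos := hT
      T_small := by rwa [le_div_iff₀' (by positivity)] at hT₀ }
  exact ⟨hshort, fun s hs μ => hshort.exists_isCharSystem hs μ hrc hr hrR'
    (fun q q' p p' => (hK₀.norm_gradHq_sub_le _ _ _ _ (hrR' p) (hrR' p')).trans (hlip q q' p p'))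
    (fun q q' p p' => (hK₀.norm_gradHp_sub_le _ _ _ _ (hrR' p) (hrR' p')).trans (hlip q q' p p'))⟩

/-! ### The value carried by the characteristics -/

/-- The time derivative of `characteristicValue`. -/
noncomputable def lagrangian (H : Rd d → Rd d → ℝ) (F : Rd d → ProbabilityMeasure (Rd d) → ℝ)
    (μ : ProbabilityMeasure (Rd d)) (Q P : ℝ → Rd d → Rd d) (t : ℝ) (q : Rd d) : ℝ :=
  inner ℝ (P t q) (gradHp H (Q t q) (P t q)) - H (Q t q) (P t q) - F (Q t q) (pushforward (Q t) μ)

lemma continuousOn_slice_time {E : Type*} [TopologicalSpace E] {f : ℝ → Rd d → E} {T : ℝ}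
    (hf : ContinuousOn (fun z : ℝ × Rd d => f z.1 z.2) (Icc 0 T ×ˢ univ)) (q : Rd d) :
    ContinuousOn (fun t => f t q) (Icc 0 T) :=
  hf.comp (f := fun t => (t, q)) (by fun_prop) fun _ ht => ⟨ht, mem_univ q⟩

/-- The fundamental theorem of calculus on a closed interval, with one-sided derivatives at its
endpoints. -/
lemma hasDerivWithinAt_integral_of_continuousOn {f : ℝ → ℝ} {T : ℝ} (hT : 0 ≤ T)
    (hf : ContinuousOn f (Icc 0 T)) {t : ℝ} (ht : t ∈ Icc 0 T) :
    HasDerivWithinAt (fun t => ∫ τ in (0 : ℝ)..t, f τ) (f t) (Icc 0 T) t := by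
  have hc : Continuous (IccExtend hT (domRestrict (Icc 0 T) f)) := hf.domRestrict.Icc_extend'
  have hext : ∀ τ ∈ Icc 0 T, IccExtend hT (domRestrict (Icc 0 T) f) τ = f τ := fun τ hτ =>
    IccExtend_of_mem hT _ hτ
  have h := (hc.integral_hasStrictDerivAt 0 t).hasDerivAt.hasDerivWithinAt (s := Icc 0 T)
  rw [hext t ht] at h
  refine h.congr_of_mem (fun τ hτ => intervalIntegral.integral_congr fun u hu => ?_) ht
  rw [uIcc_of_le hτ.1] at hu
  exact (hext u ⟨hu.1, hu.2.trans hτ.2⟩).symm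

lemma IsHamiltonian.continuous {H : Rd d → Rd d → ℝ} (hH : IsHamiltonian H) :
    Continuous fun z : Rd d × Rd d => H z.1 z.2 := hH.contDiff.continuous

namespace IsShortTime

variable {H : Rd d → Rd d → ℝ} {F g : Rd d → ProbabilityMeasure (Rd d) → ℝ} {κ K T s : ℝ}
  {μ : ProbabilityMeasure (Rd d)} {Q P : ℝ → Rd d → Rd d}

lemma continuousOn_coupling (h : IsShortTime H F g κ K T) (hc : IsCharSystem H F g T s μ Q P) :
    ContinuousOn (fun z : ℝ × Rd d => F z.2 (pushforward (Q z.1) μ)) (Icc 0 T ×ˢ univ) := by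
  rintro ⟨t₀, q₀⟩ ⟨ht₀, -⟩
  rw [Metric.continuousWithinAt_iff]
  intro ε hε
  obtain ⟨δ, hδ, hδF⟩ := h.coupling.continuous_measure q₀ (pushforward (Q t₀) μ)
    (ε / 2) (half_pos hε)
  have hK := h.one_le
  refine ⟨min (δ / K) (ε / (2 * K)), by positivity, ?_⟩
  rintro ⟨t, q⟩ ⟨ht, -⟩ hd
  simp only [dist_eq_norm, Prod.mk_sub_mk, Prod.norm_def, max_lt_iff, lt_min_iff] at hd
  obtain ⟨⟨h1, -⟩, -, h2⟩ := hd
  have hW : torusW (pushforward (Q t₀) μ) (pushforward (Q t) μ) < δ := by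
    refine (h.torusW_flow_le hc ht₀ ht).trans_lt ?_
    rwa [lt_div_iff₀' (by positivity), Real.norm_eq_abs, abs_sub_comm] at h1
  have e1 := hδF _ hW
  have e2 := h.coupling.abs_sub_le q q₀ (pushforward (Q t) μ)
  have e3 : κ * ‖q - q₀‖ ≤ K * ‖q - q₀‖ := mul_le_mul_of_nonneg_right h.κ_le (norm_nonneg _)
  rw [lt_div_iff₀' (by positivity)] at h2
  have e4 := abs_sub_le (F q (pushforward (Q t) μ)) (F q₀ (pushforward (Q t) μ))
    (F q₀ (pushforward (Q t₀) μ))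
  rw [Real.dist_eq]
  dsimp only at *
  linarith

lemma continuousOn_lagrangian (h : IsShortTime H F g κ K T) (hc : IsCharSystem H F g T s μ Q P) :
    ContinuousOn (fun z : ℝ × Rd d => lagrangian H F μ Q P z.1 z.2) (Icc 0 T ×ˢ univ) := by
  have hQP : ContinuousOn (fun z : ℝ × Rd d => (Q z.1 z.2, P z.1 z.2)) (Icc 0 T ×ˢ univ) :=
    hc.continuous_Q.prodMk hc.continuous_P
  refine ((hc.continuous_P.inner (h.hamiltonian.continuous_gradHp.comp_continuousOn hQP)).sub
    (h.hamiltonian.continuous.comp_continuousOn hQP)).sub ?_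
  exact (h.continuousOn_coupling hc).comp (f := fun z : ℝ × Rd d => (z.1, Q z.1 z.2))
    (continuousOn_fst.prodMk hc.continuous_Q) fun z hz => ⟨hz.1, mem_univ _⟩

lemma hasDerivWithinAt_characteristicValue (h : IsShortTime H F g κ K T)
    (hc : IsCharSystem H F g T s μ Q P) {t : ℝ} (ht : t ∈ Icc 0 T) (q : Rd d) :
    HasDerivWithinAt (fun t => characteristicValue H F g μ Q P t q) (lagrangian H F μ Q P t q)
      (Icc 0 T) t :=
  (hasDerivWithinAt_integral_of_continuousOn h.T_pos.le
    (continuousOn_slice_time (h.continuousOn_lagrangian hc) q) ht).const_add _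

/-- First-order expansion of the value between two characteristics. By the Hamiltonian system the
terms of first order in the time derivative of the remainder cancel. -/
lemma characteristicValue_taylor (h : IsShortTime H F g κ K T) (hs : s ∈ Icc 0 T)
    (hc : IsCharSystem H F g T s μ Q P) {t : ℝ} (ht : t ∈ Icc 0 T) (q q' : Rd d) :
    |characteristicValue H F g μ Q P t q' - characteristicValue H F g μ Q P t q
      - inner ℝ (P t q) (Q t q' - Q t q)| ≤ 5 * K * ‖q' - q‖ ^ 2 := by
  have hK := h.one_le
  have hK0 := h.K_nonneg
  set N := ‖q' - q‖ with hN
  have hN0 : 0 ≤ N := norm_nonneg _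
  have hflow : ∀ t ∈ Icc 0 T, ‖Q t q' - Q t q‖ ≤ 2 * N ∧ ‖P t q' - P t q‖ ≤ 4 * K * N :=
    fun t ht => ⟨h.norm_flow_sub_le hs hc ht q' q, (h.norm_flow_sub_sub_le hs hc ht q' q).2⟩
  have hderiv : ∀ t ∈ Icc 0 T, HasDerivWithinAt
      (fun t => characteristicValue H F g μ Q P t q' - characteristicValue H F g μ Q P t q
        - inner ℝ (P t q) (Q t q' - Q t q))
      (lagrangian H F μ Q P t q' - lagrangian H F μ Q P t q
        - (inner ℝ (P t q) (gradHp H (Q t q') (P t q') - gradHp H (Q t q) (P t q))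
          + inner ℝ (-gradHq H (Q t q) (P t q) - gradq F (Q t q) (pushforward (Q t) μ))
            (Q t q' - Q t q))) (Icc 0 T) t := fun t ht =>
    ((h.hasDerivWithinAt_characteristicValue hc ht q').sub
      (h.hasDerivWithinAt_characteristicValue hc ht q)).sub
      (((hc.curve q).deriv_p t ht).inner ℝ
        (((hc.curve q').deriv_x t ht).sub ((hc.curve q).deriv_x t ht)))
  have hbound : ∀ t ∈ Icc 0 T, ‖lagrangian H F μ Q P t q' - lagrangian H F μ Q P t q
        - (inner ℝ (P t q) (gradHp H (Q t q') (P t q') - gradHp H (Q t q) (P t q))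
          + inner ℝ (-gradHq H (Q t q) (P t q) - gradq F (Q t q) (pushforward (Q t) μ))
            (Q t q' - Q t q))‖ ≤ 108 * K ^ 3 * N ^ 2 := by
    intro t ht
    have hp := h.norm_momentum_le' (hc.curve q) t ht
    have hp' := h.norm_momentum_le' (hc.curve q') t ht
    have e1 := h.bounds.taylor (Q t q) (Q t q') (P t q) (P t q') hp hp'
    have e2 := h.coupling.taylor h.κ_nonneg (Q t q) (Q t q') (pushforward (Q t) μ)
    have e3 : |inner ℝ (P t q' - P t q)
        (gradHp H (Q t q') (P t q') - gradHp H (Q t q) (P t q))| ≤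
        ‖P t q' - P t q‖ * (K * (‖Q t q' - Q t q‖ + ‖P t q' - P t q‖)) :=
      (abs_real_inner_le_norm _ _).trans (mul_le_mul_of_nonneg_left
        (h.bounds.norm_gradHp_sub_le _ _ _ _ hp' hp) (norm_nonneg _))
    -- subtracting the Taylor expansions of `H` and `F` leaves only products of two differences
    have hid : lagrangian H F μ Q P t q' - lagrangian H F μ Q P t q
        - (inner ℝ (P t q) (gradHp H (Q t q') (P t q') - gradHp H (Q t q) (P t q))
          + inner ℝ (-gradHq H (Q t q) (P t q) - gradq F (Q t q) (pushforward (Q t) μ))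
            (Q t q' - Q t q))
        = inner ℝ (P t q' - P t q) (gradHp H (Q t q') (P t q') - gradHp H (Q t q) (P t q))
          - (H (Q t q') (P t q') - H (Q t q) (P t q)
            - inner ℝ (gradHq H (Q t q) (P t q)) (Q t q' - Q t q)
            - inner ℝ (gradHp H (Q t q) (P t q)) (P t q' - P t q))
          - (F (Q t q') (pushforward (Q t) μ) - F (Q t q) (pushforward (Q t) μ)
            - inner ℝ (gradq F (Q t q) (pushforward (Q t) μ)) (Q t q' - Q t q)) := by
      rw [real_inner_comm (P t q' - P t q) (gradHp H (Q t q) (P t q))]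
      simp only [lagrangian, inner_sub_left, inner_sub_right, inner_neg_left]
      ring
    rw [hid, Real.norm_eq_abs]
    obtain ⟨f1, f2⟩ := hflow t ht
    have n1 := norm_nonneg (Q t q' - Q t q)
    have n2 := norm_nonneg (P t q' - P t q)
    set A := ‖Q t q' - Q t q‖
    set B := ‖P t q' - P t q‖
    have hAB : A + B ≤ 6 * K * N := by nlinarith
    have hAB2 : (A + B) ^ 2 ≤ (6 * K * N) ^ 2 := pow_le_pow_left₀ (by positivity) hAB 2
    have e4 : κ * A ^ 2 ≤ K * (A + B) ^ 2 :=
      mul_le_mul h.κ_le (pow_le_pow_left₀ n1 (by linarith) 2) (sq_nonneg _) hK0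
    have e5 : B * (K * (A + B)) ≤ K * (A + B) ^ 2 := by
      nlinarith [mul_nonneg hK0 (mul_nonneg n1 (add_nonneg n1 n2))]
    have e6 : K * (A + B) ^ 2 ≤ K * (6 * K * N) ^ 2 := mul_le_mul_of_nonneg_left hAB2 hK0
    refine (abs_sub _ _).trans ?_
    refine (add_le_add_left (abs_sub _ _) _).trans ?_
    calc _ ≤ B * (K * (A + B)) + K * (A + B) ^ 2 + κ * A ^ 2 := add_le_add (add_le_add e3 e1) e2
      _ ≤ 3 * (K * (6 * K * N) ^ 2) := by linarith
      _ = 108 * K ^ 3 * N ^ 2 := by ring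
  have h1 := norm_sub_le_of_hasDerivWithinAt hderiv hbound ht h.zero_mem
  have h2 : |characteristicValue H F g μ Q P 0 q' - characteristicValue H F g μ Q P 0 q
      - inner ℝ (P 0 q) (Q 0 q' - Q 0 q)| ≤ 4 * K * N ^ 2 := by
    have e := h.initialCoupling.taylor h.κ_nonneg (Q 0 q) (Q 0 q') (pushforward (Q 0) μ)
    simp only [characteristicValue, intervalIntegral.integral_same, add_zero, (hc.curve q).initial]
    refine e.trans ?_
    calc κ * ‖Q 0 q' - Q 0 q‖ ^ 2 ≤ K * (2 * N) ^ 2 :=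
          mul_le_mul h.κ_le (pow_le_pow_left₀ (norm_nonneg _) (hflow 0 h.zero_mem).1 2)
            (sq_nonneg _) hK0
      _ = 4 * K * N ^ 2 := by ring
  have h3 : 108 * K ^ 3 * N ^ 2 * |t - 0| ≤ K * N ^ 2 := by
    have e1 : |t - 0| ≤ T := abs_sub_le_of_mem_Icc ht h.zero_mem
    calc 108 * K ^ 3 * N ^ 2 * |t - 0| ≤ 108 * K ^ 3 * N ^ 2 * T :=
          mul_le_mul_of_nonneg_left e1 (by positivity)
      _ = (108 * K ^ 2 * T) * (K * N ^ 2) := by ring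
      _ ≤ 1 * (K * N ^ 2) := by
          refine mul_le_mul_of_nonneg_right ?_ (by positivity)
          linarith [h.T_small, mul_nonneg (sq_nonneg K) h.T_pos.le]
      _ = K * N ^ 2 := one_mul _
  rw [Real.norm_eq_abs] at h1
  have h4 := abs_sub_abs_le_abs_sub
    (characteristicValue H F g μ Q P t q' - characteristicValue H F g μ Q P t q
      - inner ℝ (P t q) (Q t q' - Q t q))
    (characteristicValue H F g μ Q P 0 q' - characteristicValue H F g μ Q P 0 q
      - inner ℝ (P 0 q) (Q 0 q' - Q 0 q))
  linarith

/-! ### The inverse flow and the momentum field -/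

lemma flow_invFun (h : IsShortTime H F g κ K T) (hs : s ∈ Icc 0 T)
    (hc : IsCharSystem H F g T s μ Q P) {t : ℝ} (ht : t ∈ Icc 0 T) (x : Rd d) :
    Q t (Function.invFun (Q t) x) = x :=
  Function.invFun_eq ((h.bijective hs hc ht).2 x)

lemma invFun_flow (h : IsShortTime H F g κ K T) (hs : s ∈ Icc 0 T)
    (hc : IsCharSystem H F g T s μ Q P) {t : ℝ} (ht : t ∈ Icc 0 T) (q : Rd d) :
    Function.invFun (Q t) (Q t q) = q :=
  Function.leftInverse_invFun (h.bijective hs hc ht).1 q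

lemma invFun_flow_add_latticeVec (h : IsShortTime H F g κ K T) (hs : s ∈ Icc 0 T)
    (hc : IsCharSystem H F g T s μ Q P) {t : ℝ} (ht : t ∈ Icc 0 T) (x : Rd d) (n : Fin d → ℤ) :
    Function.invFun (Q t) (x + latticeVec n) = Function.invFun (Q t) x + latticeVec n := by
  apply (h.bijective hs hc ht).1
  rw [h.flow_invFun hs hc ht, (h.flow_add_latticeVec hs hc ht _ n).1, h.flow_invFun hs hc ht]

lemma norm_invFun_sub_le (h : IsShortTime H F g κ K T) (hs : s ∈ Icc 0 T)
    (hc : IsCharSystem H F g T s μ Q P) {t t' : ℝ} (ht : t ∈ Icc 0 T) (ht' : t' ∈ Icc 0 T)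
    (x x' : Rd d) :
    ‖Function.invFun (Q t) x - Function.invFun (Q t') x'‖ ≤ 2 * ‖x - x'‖ + 2 * K * |t - t'| := by
  set q := Function.invFun (Q t) x
  set q' := Function.invFun (Q t') x'
  have h1 := h.norm_sub_le_two_mul hs hc ht q q'
  have h2 := h.norm_curve_sub_le (hc.curve q') ht' ht
  have h3 : Q t q = x := h.flow_invFun hs hc ht x
  have h4 : Q t' q' = x' := h.flow_invFun hs hc ht' x'
  rw [h3] at h1
  rw [h4, abs_sub_comm] at h2
  have h5 : ‖x - Q t q'‖ ≤ ‖x - x'‖ + ‖x' - Q t q'‖ := norm_sub_le_norm_sub_add_norm_sub _ _ _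
  linarith

end IsShortTime

/-- The momentum as a function of the position; it is the gradient of the value function. -/
noncomputable def momentumField (Q P : ℝ → Rd d → Rd d) (t : ℝ) (x : Rd d) : Rd d :=
  P t (Function.invFun (Q t) x)

namespace IsShortTime

variable {H : Rd d → Rd d → ℝ} {F g : Rd d → ProbabilityMeasure (Rd d) → ℝ} {κ K T s : ℝ}
  {μ : ProbabilityMeasure (Rd d)} {Q P : ℝ → Rd d → Rd d}

lemma momentumField_flow (h : IsShortTime H F g κ K T) (hs : s ∈ Icc 0 T)
    (hc : IsCharSystem H F g T s μ Q P) {t : ℝ} (ht : t ∈ Icc 0 T) (q : Rd d) :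
    momentumField Q P t (Q t q) = P t q := by
  rw [momentumField, h.invFun_flow hs hc ht]

lemma norm_momentumField_le (h : IsShortTime H F g κ K T) (hc : IsCharSystem H F g T s μ Q P)
    {t : ℝ} (ht : t ∈ Icc 0 T) (x : Rd d) : ‖momentumField Q P t x‖ ≤ κ + 2 :=
  h.norm_momentum_le' (hc.curve _) t ht

lemma norm_momentumField_sub_le (h : IsShortTime H F g κ K T) (hs : s ∈ Icc 0 T)
    (hc : IsCharSystem H F g T s μ Q P) {t t' : ℝ} (ht : t ∈ Icc 0 T) (ht' : t' ∈ Icc 0 T)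
    (x x' : Rd d) :
    ‖momentumField Q P t x - momentumField Q P t' x'‖ ≤
      18 * K ^ 2 * ‖((t, x) : ℝ × Rd d) - (t', x')‖ := by
  have hK := h.one_le
  set q := Function.invFun (Q t) x
  set q' := Function.invFun (Q t') x'
  have h1 : ‖P t q - P t q'‖ ≤ _ := (h.norm_flow_sub_sub_le hs hc ht q q').2
  have h2 : ‖P t q' - P t' q'‖ ≤ _ := h.norm_momentum_sub_le (hc.curve q') ht ht'
  have h3 : ‖q - q'‖ ≤ _ := h.norm_invFun_sub_le hs hc ht ht' x x'
  have h4 : ‖x - x'‖ ≤ ‖((t, x) : ℝ × Rd d) - (t', x')‖ := norm_snd_le ((t, x) - (t', x'))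
  have h5 : |t - t'| ≤ ‖((t, x) : ℝ × Rd d) - (t', x')‖ := norm_fst_le ((t, x) - (t', x'))
  have h6 : ‖P t q - P t' q'‖ ≤ ‖P t q - P t q'‖ + ‖P t q' - P t' q'‖ :=
    norm_sub_le_norm_sub_add_norm_sub _ _ _
  have h7 := norm_nonneg (((t, x) : ℝ × Rd d) - (t', x'))
  set N := ‖((t, x) : ℝ × Rd d) - (t', x')‖
  have hK0 := h.K_nonneg
  have h8 : ‖q - q'‖ ≤ 2 * N + 2 * K * N := by nlinarith
  have h9 : 4 * K * ‖q - q'‖ ≤ 4 * K * (2 * N + 2 * K * N) :=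
    mul_le_mul_of_nonneg_left h8 (by positivity)
  have h10 : 2 * K * |t - t'| ≤ 2 * K * N := mul_le_mul_of_nonneg_left h5 (by positivity)
  have h11 : K * N ≤ K ^ 2 * N := by nlinarith [mul_nonneg hK0 h7]
  change ‖P t q - P t' q'‖ ≤ _
  nlinarith

lemma continuousOn_momentumField (h : IsShortTime H F g κ K T) (hs : s ∈ Icc 0 T)
    (hc : IsCharSystem H F g T s μ Q P) :
    ContinuousOn (fun z : ℝ × Rd d => momentumField Q P z.1 z.2) (Icc 0 T ×ˢ univ) := by
  refine (LipschitzOnWith.of_dist_le_mul (K := (18 * K ^ 2).toNNReal)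
    fun z hz z' hz' => ?_).continuousOn
  rw [dist_eq_norm, dist_eq_norm, Real.coe_toNNReal _ (by positivity)]
  exact h.norm_momentumField_sub_le hs hc hz.1 hz'.1 z.2 z'.2

/-! ### Regularity of the value function and the Hamilton–Jacobi equation -/

lemma valueFunction_flow (h : IsShortTime H F g κ K T) (hs : s ∈ Icc 0 T)
    (hc : IsCharSystem H F g T s μ Q P) {t : ℝ} (ht : t ∈ Icc 0 T) (q : Rd d) :
    valueFunction H F g μ Q P t (Q t q) = characteristicValue H F g μ Q P t q := by
  rw [valueFunction, h.invFun_flow hs hc ht]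

lemma valueFunction_taylor (h : IsShortTime H F g κ K T) (hs : s ∈ Icc 0 T)
    (hc : IsCharSystem H F g T s μ Q P) {t : ℝ} (ht : t ∈ Icc 0 T) (q x : Rd d) :
    |valueFunction H F g μ Q P t x - characteristicValue H F g μ Q P t q
      - inner ℝ (P t q) (x - Q t q)| ≤ 20 * K * ‖x - Q t q‖ ^ 2 := by
  obtain ⟨q', rfl⟩ := (h.bijective hs hc ht).2 x
  rw [h.valueFunction_flow hs hc ht]
  refine (h.characteristicValue_taylor hs hc ht q q').trans ?_
  have h1 := pow_le_pow_left₀ (norm_nonneg _) (h.norm_sub_le_two_mul hs hc ht q' q) 2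
  nlinarith [mul_le_mul_of_nonneg_left h1 h.K_nonneg]

lemma valueFunction_periodic (h : IsShortTime H F g κ K T) (hs : s ∈ Icc 0 T)
    (hc : IsCharSystem H F g T s μ Q P) {t : ℝ} (ht : t ∈ Icc 0 T) :
    TorusPeriodic (valueFunction H F g μ Q P t) := by
  intro x n
  have h0 := h.zero_mem
  rw [valueFunction, valueFunction, h.invFun_flow_add_latticeVec hs hc ht]
  set q := Function.invFun (Q t) x
  have hg : g (Q 0 q + latticeVec n) (pushforward (Q 0) μ) = g (Q 0 q) (pushforward (Q 0) μ) :=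
    h.initialCoupling.periodic _ _ n
  rw [characteristicValue, characteristicValue, (h.flow_add_latticeVec hs hc h0 q n).1, hg]
  congr 1
  refine intervalIntegral.integral_congr fun τ hτ => ?_
  rw [uIcc_of_le ht.1] at hτ
  have hτ' : τ ∈ Icc 0 T := ⟨hτ.1, hτ.2.trans ht.2⟩
  obtain ⟨e1, e2⟩ := h.flow_add_latticeVec hs hc hτ' q n
  have hH : H (Q τ q + latticeVec n) (P τ q) = H (Q τ q) (P τ q) :=
    h.hamiltonian.periodic _ _ n
  have hF : F (Q τ q + latticeVec n) (pushforward (Q τ) μ) = F (Q τ q) (pushforward (Q τ) μ) :=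
    h.coupling.periodic _ _ n
  simp only [e1, e2, h.hamiltonian.gradHp_add_latticeVec, hH, hF]

end IsShortTime

/-- The candidate for the differential of the value function in time and space. -/
noncomputable def valueDifferential (H : Rd d → Rd d → ℝ)
    (F : Rd d → ProbabilityMeasure (Rd d) → ℝ) (μ : ProbabilityMeasure (Rd d))
    (Q P : ℝ → Rd d → Rd d) (z : ℝ × Rd d) : ℝ × Rd d →L[ℝ] ℝ :=
  (-H z.2 (momentumField Q P z.1 z.2) - F z.2 (pushforward (Q z.1) μ)) •
      ContinuousLinearMap.fst ℝ ℝ (Rd d)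
    + (innerSL ℝ (momentumField Q P z.1 z.2)).comp (ContinuousLinearMap.snd ℝ ℝ (Rd d))

lemma valueDifferential_apply (H : Rd d → Rd d → ℝ) (F : Rd d → ProbabilityMeasure (Rd d) → ℝ)
    (μ : ProbabilityMeasure (Rd d)) (Q P : ℝ → Rd d → Rd d) (z : ℝ × Rd d) (τ : ℝ) (v : Rd d) :
    valueDifferential H F μ Q P z (τ, v) =
      (-H z.2 (momentumField Q P z.1 z.2) - F z.2 (pushforward (Q z.1) μ)) * τ
        + inner ℝ (momentumField Q P z.1 z.2) v := rfl

namespace IsShortTime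

variable {H : Rd d → Rd d → ℝ} {F g : Rd d → ProbabilityMeasure (Rd d) → ℝ} {κ K T s : ℝ}
  {μ : ProbabilityMeasure (Rd d)} {Q P : ℝ → Rd d → Rd d}

/-- Near `(t,x)` the value function agrees up to second order with its expansion along the
characteristic that passes through `x` at time `t`. -/
theorem hasFDerivWithinAt_valueFunction (h : IsShortTime H F g κ K T) (hs : s ∈ Icc 0 T)
    (hc : IsCharSystem H F g T s μ Q P) {z : ℝ × Rd d} (hz : z ∈ Icc 0 T ×ˢ (univ : Set (Rd d))) :
    HasFDerivWithinAt (fun z : ℝ × Rd d => valueFunction H F g μ Q P z.1 z.2)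
      (valueDifferential H F μ Q P z) (Icc 0 T ×ˢ univ) z := by
  obtain ⟨t, x⟩ := z
  have ht : t ∈ Icc 0 T := hz.1
  obtain ⟨q, rfl⟩ := (h.bijective hs hc ht).2 x
  have hfst : HasFDerivWithinAt (fun z : ℝ × Rd d => z.1) (ContinuousLinearMap.fst ℝ ℝ (Rd d))
      (Icc 0 T ×ˢ univ) (t, Q t q) := hasFDerivWithinAt_fst
  have hmaps : MapsTo (fun z : ℝ × Rd d => z.1) (Icc 0 T ×ˢ univ) (Icc 0 T) := fun z hz => hz.1
  have hz' := (h.hasDerivWithinAt_characteristicValue hc ht q).comp_hasFDerivWithinAt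
    (t, Q t q) hfst hmaps
  have hQ' := ((hc.curve q).deriv_x t ht).hasFDerivWithinAt.comp (t, Q t q) hfst hmaps
  have hP' := ((hc.curve q).deriv_p t ht).hasFDerivWithinAt.comp (t, Q t q) hfst hmaps
  have hA := hz'.add (hP'.inner ℝ (hasFDerivWithinAt_snd.sub hQ'))
  have hR : HasFDerivWithinAt (fun z : ℝ × Rd d => valueFunction H F g μ Q P z.1 z.2
      - (characteristicValue H F g μ Q P z.1 q + inner ℝ (P z.1 q) (z.2 - Q z.1 q)))
      (0 : ℝ × Rd d →L[ℝ] ℝ) (Icc 0 T ×ˢ univ) (t, Q t q) := by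
    refine HasFDerivWithinAt.of_isLittleO ?_
    have hbig : (fun z : ℝ × Rd d => valueFunction H F g μ Q P z.1 z.2
        - (characteristicValue H F g μ Q P z.1 q + inner ℝ (P z.1 q) (z.2 - Q z.1 q)))
        =O[𝓝[Icc 0 T ×ˢ univ] (t, Q t q)] fun z => ‖z - (t, Q t q)‖ ^ 2 := by
      refine Asymptotics.IsBigO.of_bound (20 * K * (1 + K) ^ 2) ?_
      filter_upwards [self_mem_nhdsWithin] with z hz
      have h1 := h.valueFunction_taylor hs hc hz.1 q z.2
      have h2 : ‖z.2 - Q z.1 q‖ ≤ (1 + K) * ‖z - (t, Q t q)‖ := by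
        have e1 : ‖z.2 - Q t q‖ ≤ ‖z - (t, Q t q)‖ := norm_snd_le (z - (t, Q t q))
        have e2 : |z.1 - t| ≤ ‖z - (t, Q t q)‖ := norm_fst_le (z - (t, Q t q))
        have e3 := h.norm_curve_sub_le (hc.curve q) ht hz.1
        have e4 : ‖z.2 - Q z.1 q‖ ≤ ‖z.2 - Q t q‖ + ‖Q t q - Q z.1 q‖ :=
          norm_sub_le_norm_sub_add_norm_sub _ _ _
        rw [abs_sub_comm] at e3
        have e5 := mul_le_mul_of_nonneg_left e2 h.K_nonneg
        linarith
      rw [← sub_sub, Real.norm_eq_abs, norm_pow, norm_norm]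
      refine h1.trans ?_
      calc 20 * K * ‖z.2 - Q z.1 q‖ ^ 2 ≤ 20 * K * ((1 + K) * ‖z - (t, Q t q)‖) ^ 2 :=
            mul_le_mul_of_nonneg_left (pow_le_pow_left₀ (norm_nonneg _) h2 2)
              (mul_nonneg (by norm_num) h.K_nonneg)
        _ = 20 * K * (1 + K) ^ 2 * ‖z - (t, Q t q)‖ ^ 2 := by ring
    have hzero : valueFunction H F g μ Q P t (Q t q)
        - (characteristicValue H F g μ Q P t q + inner ℝ (P t q) (Q t q - Q t q)) = 0 := by
      rw [h.valueFunction_flow hs hc ht, sub_self, inner_zero_right, add_zero, sub_self]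
    simp only [hzero, sub_zero, zero_apply]
    refine hbig.trans_isLittleO ?_
    have hlim : Tendsto (fun z : ℝ × Rd d => z - (t, Q t q))
        (𝓝[Icc 0 T ×ˢ univ] (t, Q t q)) (𝓝 0) := by
      refine (Continuous.tendsto' (by fun_prop) _ _ (by simp)).mono_left nhdsWithin_le_nhds
    exact (Asymptotics.isLittleO_norm_pow_id one_lt_two).comp_tendsto hlim
  have hsum := hA.add hR
  refine (hsum.congr_fderiv ?_).congr (fun z _ => ?_) ?_
  · ext1 <;> ext <;> simp [valueDifferential, h.momentumField_flow hs hc ht, lagrangian]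
    ring
  · simp
  · simp

lemma continuousOn_valueFunction (h : IsShortTime H F g κ K T) (hs : s ∈ Icc 0 T)
    (hc : IsCharSystem H F g T s μ Q P) :
    ContinuousOn (fun z : ℝ × Rd d => valueFunction H F g μ Q P z.1 z.2) (Icc 0 T ×ˢ univ) :=
  fun _ hz => (h.hasFDerivWithinAt_valueFunction hs hc hz).continuousWithinAt

lemma hasFDerivAt_valueFunction (h : IsShortTime H F g κ K T) (hs : s ∈ Icc 0 T)
    (hc : IsCharSystem H F g T s μ Q P) {z : ℝ × Rd d} (hz : z ∈ cylinder d T) :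
    HasFDerivAt (fun z : ℝ × Rd d => valueFunction H F g μ Q P z.1 z.2)
      (valueDifferential H F μ Q P z) z :=
  (h.hasFDerivWithinAt_valueFunction hs hc ⟨Ioo_subset_Icc_self hz.1, mem_univ _⟩).hasFDerivAt
    (prod_mem_nhds (Icc_mem_nhds hz.1.1 hz.1.2) univ_mem)

theorem hasGradientAt_valueFunction (h : IsShortTime H F g κ K T) (hs : s ∈ Icc 0 T)
    (hc : IsCharSystem H F g T s μ Q P) {t : ℝ} (ht : t ∈ Icc 0 T) (x : Rd d) :
    HasGradientAt (valueFunction H F g μ Q P t) (momentumField Q P t x) x := by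
  have h1 := (h.hasFDerivWithinAt_valueFunction hs hc (z := (t, x)) ⟨ht, mem_univ _⟩).comp
    x (s := univ) (f := fun x => (t, x)) (hasFDerivAt_prodMk_right t x).hasFDerivWithinAt
    (fun _ _ => ⟨ht, mem_univ _⟩)
  rw [hasFDerivWithinAt_univ] at h1
  rw [hasGradientAt_iff_hasFDerivAt]
  refine h1.congr_fderiv ?_
  ext v
  simp [valueDifferential_apply]

lemma hasDerivAt_valueFunction (h : IsShortTime H F g κ K T) (hs : s ∈ Icc 0 T)
    (hc : IsCharSystem H F g T s μ Q P) {t : ℝ} (ht : t ∈ Ioo 0 T) (x : Rd d) :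
    HasDerivAt (fun t => valueFunction H F g μ Q P t x)
      (-H x (momentumField Q P t x) - F x (pushforward (Q t) μ)) t := by
  have h1 := (h.hasFDerivAt_valueFunction hs hc (z := (t, x)) ⟨ht, mem_univ _⟩).comp_hasDerivAt t
    (f := fun t => (t, x)) ((hasDerivAt_id t).prodMk (hasDerivAt_const t x))
  refine h1.congr_deriv ?_
  simp [valueDifferential_apply]

lemma continuousOn_timeDerivative (h : IsShortTime H F g κ K T) (hs : s ∈ Icc 0 T)
    (hc : IsCharSystem H F g T s μ Q P) :
    ContinuousOn (fun z : ℝ × Rd d =>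
      -H z.2 (momentumField Q P z.1 z.2) - F z.2 (pushforward (Q z.1) μ)) (Icc 0 T ×ˢ univ) :=
  (h.hamiltonian.continuous.comp_continuousOn
    (continuousOn_snd.prodMk (h.continuousOn_momentumField hs hc))).neg.sub
    (h.continuousOn_coupling hc)

theorem contDiffOn_valueFunction (h : IsShortTime H F g κ K T) (hs : s ∈ Icc 0 T)
    (hc : IsCharSystem H F g T s μ Q P) :
    ContDiffOn ℝ 1 (fun z : ℝ × Rd d => valueFunction H F g μ Q P z.1 z.2)
      (Ioo 0 T ×ˢ univ) := by
  have hopen : IsOpen (Ioo 0 T ×ˢ (univ : Set (Rd d))) := isOpen_Ioo.prod isOpen_univ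
  rw [show (1 : ℕ∞ω) = 0 + 1 by norm_num, contDiffOn_succ_iff_fderiv_of_isOpen hopen]
  refine ⟨fun z hz =>
    (h.hasFDerivAt_valueFunction hs hc hz).differentiableAt.differentiableWithinAt,
    by simp, ?_⟩
  rw [contDiffOn_zero]
  have hcont : ContinuousOn (valueDifferential H F μ Q P) (Icc 0 T ×ˢ univ) :=
    ((h.continuousOn_timeDerivative hs hc).smul continuousOn_const).add
      (((innerSL ℝ).continuous.comp_continuousOn (h.continuousOn_momentumField hs hc)).clm_comp
        continuousOn_const)
  exact (hcont.mono (prod_mono_left Ioo_subset_Icc_self)).congr fun z hz =>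
    (h.hasFDerivAt_valueFunction hs hc hz).fderiv

end IsShortTime

/-! ### Weak derivatives of Lipschitz functions -/

lemma isOpen_cylinder (d : ℕ) (T : ℝ) : IsOpen (cylinder d T) := isOpen_Ioo.prod isOpen_univ

lemma IsWeakDeriv.congr {T : ℝ} {e : ℝ × Rd d} {u u' v v' : ℝ × Rd d → ℝ}
    (h : IsWeakDeriv T e u v) (hu : EqOn u u' (cylinder d T)) (hv : EqOn v v' (cylinder d T)) :
    IsWeakDeriv T e u' v' := by
  intro φ h1 h2 h3
  have hm := (isOpen_cylinder d T).measurableSet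
  rw [← setIntegral_congr_fun hm fun z hz => congrArg (· * fderiv ℝ φ z e) (hu hz),
    ← setIntegral_congr_fun hm fun z hz => congrArg (· * φ z) (hv hz)]
  exact h φ h1 h2 h3

/-- A Lipschitz function has bounded weak derivatives, given by its line derivatives. -/
theorem exists_isWeakDeriv_of_lipschitzOnWith {T : ℝ} {C : NNReal} {u : ℝ × Rd d → ℝ}
    (hu : LipschitzOnWith C u (cylinder d T)) (e : ℝ × Rd d) :
    ∃ v, EssBounded T v ∧ IsWeakDeriv T e u v ∧ ∀ z ∈ cylinder d T, v z = lineDeriv ℝ u z e := by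
  obtain ⟨f, hf, hfu⟩ := hu.extend_real
  refine ⟨fun z => lineDeriv ℝ f z e, ?_, ?_, fun z hz => ?_⟩
  · exact memLp_top_of_bound (measurable_lineDeriv hf.continuous).aestronglyMeasurable (C * ‖e‖)
      (Eventually.of_forall fun z => norm_lineDeriv_le_of_lipschitz ℝ hf)
  · refine IsWeakDeriv.congr (u := f) ?_ hfu.symm fun _ _ => rfl
    intro φ hφ hsupp hcyl
    obtain ⟨D, hD⟩ := (hφ.of_le (by simp) : ContDiff ℝ 1 φ).lipschitzWith_of_hasCompactSupport hsupp
      (by norm_num)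
    have hzero : ∀ z ∉ cylinder d T, z ∉ tsupport φ := fun z hz hz' => hz (hcyl hz')
    rw [setIntegral_eq_integral_of_forall_compl_eq_zero fun z hz => by
        rw [fderiv_of_notMem_tsupport (𝕜 := ℝ) (hzero z hz)]; simp,
      setIntegral_eq_integral_of_forall_compl_eq_zero fun z hz => by
        rw [image_eq_zero_of_notMem_tsupport (hzero z hz), mul_zero]]
    have : (volume : Measure (ℝ × Rd d)).IsAddHaarMeasure :=
      inferInstanceAs (((volume : Measure ℝ).prod (volume : Measure (Rd d))).IsAddHaarMeasure)
    have h1 := hf.integral_lineDeriv_mul_eq (μ := volume) hD hsupp e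
    rw [h1, ← integral_neg]
    refine integral_congr_ae (Eventually.of_forall fun z => ?_)
    have h2 : lineDeriv ℝ φ z (-e) = -fderiv ℝ φ z e := by
      rw [(hφ.differentiable (by simp) z).lineDeriv_eq_fderiv, map_neg]
    simp only [h2]
    ring
  · refine Filter.EventuallyEq.lineDeriv_eq ?_
    filter_upwards [(isOpen_cylinder d T).mem_nhds hz] with z' hz'
    exact (hfu hz').symm

namespace IsShortTime

variable {H : Rd d → Rd d → ℝ} {F g : Rd d → ProbabilityMeasure (Rd d) → ℝ} {κ K T s : ℝ}
  {μ : ProbabilityMeasure (Rd d)} {Q P : ℝ → Rd d → Rd d}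

lemma momentumField_periodic (h : IsShortTime H F g κ K T) (hs : s ∈ Icc 0 T)
    (hc : IsCharSystem H F g T s μ Q P) {t : ℝ} (ht : t ∈ Icc 0 T) :
    TorusPeriodic (momentumField Q P t) := by
  intro x n
  rw [momentumField, momentumField, h.invFun_flow_add_latticeVec hs hc ht,
    (h.flow_add_latticeVec hs hc ht _ n).2]

lemma timeDerivative_periodic (h : IsShortTime H F g κ K T) (hs : s ∈ Icc 0 T)
    (hc : IsCharSystem H F g T s μ Q P) {t : ℝ} (ht : t ∈ Icc 0 T) :
    TorusPeriodic fun x => -H x (momentumField Q P t x) - F x (pushforward (Q t) μ) := by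
  intro x n
  have hF : F (x + latticeVec n) (pushforward (Q t) μ) = F x (pushforward (Q t) μ) :=
    h.coupling.periodic _ _ n
  have hH : H (x + latticeVec n) (momentumField Q P t x) = H x (momentumField Q P t x) :=
    h.hamiltonian.periodic _ _ n
  simp only [h.momentumField_periodic hs hc ht x n, hF, hH]

lemma exists_lipschitzOnWith_valueFunction (h : IsShortTime H F g κ K T) (hs : s ∈ Icc 0 T)
    (hc : IsCharSystem H F g T s μ Q P) :
    ∃ C, LipschitzOnWith C (fun z : ℝ × Rd d => valueFunction H F g μ Q P z.1 z.2)
      (cylinder d T) := by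
  obtain ⟨M, hM0, hM⟩ := exists_forall_norm_le_of_periodic isCompact_Icc
    (f := fun t x => -H x (momentumField Q P t x) - F x (pushforward (Q t) μ))
    (h.continuousOn_timeDerivative hs hc) fun t ht => h.timeDerivative_periodic hs hc ht
  have hκ := h.κ_nonneg
  refine ⟨(M + (κ + 2)).toNNReal, ?_⟩
  refine Convex.lipschitzOnWith_of_nnnorm_hasFDerivWithin_le
    (f' := valueDifferential H F μ Q P)
    (fun z hz => (h.hasFDerivAt_valueFunction hs hc hz).hasFDerivWithinAt) (fun z hz => ?_)
    ((convex_Ioo 0 T).prod convex_univ)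
  have ht : z.1 ∈ Icc 0 T := Ioo_subset_Icc_self hz.1
  rw [← NNReal.coe_le_coe, coe_nnnorm, Real.coe_toNNReal _ (by positivity)]
  refine ContinuousLinearMap.opNorm_le_bound _ (by positivity) fun w => ?_
  obtain ⟨τ, v⟩ := w
  rw [valueDifferential_apply, add_mul]
  refine (norm_add_le _ _).trans (add_le_add ?_ ?_)
  · rw [norm_mul]
    exact mul_le_mul (hM z.1 ht z.2) (norm_fst_le (τ, v)) (norm_nonneg _) hM0
  · exact (norm_inner_le_norm _ _).trans (mul_le_mul (h.norm_momentumField_le hc ht z.2)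
      (norm_snd_le (τ, v)) (norm_nonneg _) (by positivity))

lemma lineDeriv_valueFunction (h : IsShortTime H F g κ K T) (hs : s ∈ Icc 0 T)
    (hc : IsCharSystem H F g T s μ Q P) {z : ℝ × Rd d} (hz : z ∈ cylinder d T) (e : ℝ × Rd d) :
    lineDeriv ℝ (fun z : ℝ × Rd d => valueFunction H F g μ Q P z.1 z.2) z e =
      valueDifferential H F μ Q P z e :=
  ((h.hasFDerivAt_valueFunction hs hc hz).hasLineDerivAt e).lineDeriv

/-- The gradient of the value function is Lipschitz in time and space, and therefore has bounded
weak derivatives. -/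
theorem memW12_valueFunction (h : IsShortTime H F g κ K T) (hs : s ∈ Icc 0 T)
    (hc : IsCharSystem H F g T s μ Q P) : MemW12 T (valueFunction H F g μ Q P) := by
  obtain ⟨C, hC⟩ := h.exists_lipschitzOnWith_valueFunction hs hc
  have hcyl : cylinder d T ⊆ Icc 0 T ×ˢ univ := prod_mono_left Ioo_subset_Icc_self
  have hgrad : ∀ i, ∃ G : ℝ × Rd d → ℝ, EssBounded T G ∧
      IsWeakDeriv T (0, EuclideanSpace.single i 1)
        (fun z => valueFunction H F g μ Q P z.1 z.2) G ∧
      LipschitzOnWith (18 * K ^ 2).toNNReal G (cylinder d T) := by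
    intro i
    obtain ⟨G, hG, hG', hGeq⟩ := exists_isWeakDeriv_of_lipschitzOnWith hC
      (0, EuclideanSpace.single i 1)
    refine ⟨G, hG, hG', LipschitzOnWith.of_dist_le_mul fun z hz z' hz' => ?_⟩
    rw [hGeq z hz, hGeq z' hz', h.lineDeriv_valueFunction hs hc hz,
      h.lineDeriv_valueFunction hs hc hz', valueDifferential_apply, valueDifferential_apply,
      Real.coe_toNNReal _ (by positivity), mul_zero, mul_zero, zero_add, zero_add, dist_eq_norm,
      dist_eq_norm, ← inner_sub_left]
    refine (norm_inner_le_norm _ _).trans ?_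
    rw [PiLp.norm_single, norm_one, mul_one]
    exact h.norm_momentumField_sub_le hs hc (hcyl hz).1 (hcyl hz').1 z.2 z'.2
  choose G hG hG' hGlip using hgrad
  have hhess : ∀ i j, ∃ D, EssBounded T D ∧
      IsWeakDeriv T (0, EuclideanSpace.single j 1) (G i) D := fun i j => by
    obtain ⟨D, h1, h2, -⟩ := exists_isWeakDeriv_of_lipschitzOnWith (hGlip i)
      (0, EuclideanSpace.single j 1)
    exact ⟨D, h1, h2⟩
  choose D hD using hhess
  refine ⟨fun t ht => h.valueFunction_periodic hs hc (Ioo_subset_Icc_self ht), ?_, ?_,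
    ⟨G, D, fun i => ⟨hG i, hG' i⟩, hD⟩⟩
  · obtain ⟨M, -, hM⟩ := exists_forall_norm_le_of_periodic isCompact_Icc
      (h.continuousOn_valueFunction hs hc) fun t ht => h.valueFunction_periodic hs hc ht
    have hm := (isOpen_cylinder d T).measurableSet
    refine memLp_top_of_bound
      (((h.continuousOn_valueFunction hs hc).mono hcyl).aestronglyMeasurable hm) M ?_
    filter_upwards [ae_restrict_mem hm] with z hz
    exact hM z.1 (hcyl hz).1 z.2
  · obtain ⟨v, h1, h2, -⟩ := exists_isWeakDeriv_of_lipschitzOnWith hC (1, 0)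
    exact ⟨v, h1, h2⟩

lemma abs_hamiltonian_sub_le (h : IsShortTime H F g κ K T) {q q' p p' : Rd d} (hp : ‖p‖ ≤ κ + 2)
    (hp' : ‖p'‖ ≤ κ + 2) : |H q p - H q' p'| ≤ 2 * K * ‖((q, p) : Rd d × Rd d) - (q', p')‖ := by
  have hbound : ∀ z ∈ (univ : Set (Rd d)) ×ˢ Metric.closedBall (0 : Rd d) (κ + 2),
      ‖fderiv ℝ (fun z : Rd d × Rd d => H z.1 z.2) z‖ ≤ 2 * K := by
    intro z hz
    have hz' : ‖z.2‖ ≤ κ + 2 := mem_closedBall_zero_iff.1 hz.2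
    refine ContinuousLinearMap.opNorm_le_bound _ (mul_nonneg zero_le_two h.K_nonneg) fun w => ?_
    have h1 := h.hamiltonian.fderiv_apply z.1 z.2 w.1 w.2
    rw [h1, two_mul, add_mul]
    refine (norm_add_le _ _).trans (add_le_add ?_ ?_)
    · exact (norm_inner_le_norm _ _).trans (mul_le_mul (h.bounds.norm_gradHq_le _ _ hz')
        (norm_fst_le w) (norm_nonneg _) h.K_nonneg)
    · exact (norm_inner_le_norm _ _).trans (mul_le_mul (h.bounds.norm_gradHp_le _ _ hz')
        (norm_snd_le w) (norm_nonneg _) h.K_nonneg)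
  have hmem : ∀ q p : Rd d, ‖p‖ ≤ κ + 2 →
      (q, p) ∈ (univ : Set (Rd d)) ×ˢ Metric.closedBall (0 : Rd d) (κ + 2) :=
    fun q p hp => ⟨mem_univ _, mem_closedBall_zero_iff.2 hp⟩
  exact (convex_univ.prod (convex_closedBall _ _)).norm_image_sub_le_of_norm_fderiv_le
    (f := fun z : Rd d × Rd d => H z.1 z.2) (𝕜 := ℝ)
    (fun z _ => (h.hamiltonian.hasFDerivAt z).differentiableAt) hbound (hmem q' p' hp')
    (hmem q p hp)

/-- If the coupling is Lipschitz in the measure, the Hamilton–Jacobi equation shows that the time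
derivative of the value function is Lipschitz. -/
theorem memW22_valueFunction (h : IsShortTime H F g κ K T) (hs : s ∈ Icc 0 T)
    (hc : IsCharSystem H F g T s μ Q P) {L : ℝ}
    (hL : ∀ q ν₁ ν₂, |F q ν₁ - F q ν₂| ≤ L * torusW ν₁ ν₂) :
    MemW22 T (valueFunction H F g μ Q P) := by
  refine { h.memW12_valueFunction hs hc with time_two := ?_ }
  obtain ⟨C, hC⟩ := h.exists_lipschitzOnWith_valueFunction hs hc
  obtain ⟨v, hv, hv', hveq⟩ := exists_isWeakDeriv_of_lipschitzOnWith hC (1, 0)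
  have hK := h.one_le
  have hK0 := h.K_nonneg
  have hlip : LipschitzOnWith (36 * K ^ 3 + K + |L| * K).toNNReal v (cylinder d T) := by
    refine LipschitzOnWith.of_dist_le_mul fun z hz z' hz' => ?_
    have ht : z.1 ∈ Icc 0 T := Ioo_subset_Icc_self hz.1
    have ht' : z'.1 ∈ Icc 0 T := Ioo_subset_Icc_self hz'.1
    rw [hveq z hz, hveq z' hz', h.lineDeriv_valueFunction hs hc hz,
      h.lineDeriv_valueFunction hs hc hz', valueDifferential_apply, valueDifferential_apply,
      Real.coe_toNNReal _ (by positivity), inner_zero_right, inner_zero_right, add_zero, add_zero,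
      mul_one, mul_one, Real.dist_eq, dist_eq_norm]
    set m := momentumField Q P z.1 z.2
    set m' := momentumField Q P z'.1 z'.2
    set σ := pushforward (Q z.1) μ
    set σ' := pushforward (Q z'.1) μ
    have f1 : |z.1 - z'.1| ≤ ‖z - z'‖ := norm_fst_le (z - z')
    have f2 : ‖z.2 - z'.2‖ ≤ ‖z - z'‖ := norm_snd_le (z - z')
    have f0 := norm_nonneg (z - z')
    have e1 : |H z.2 m - H z'.2 m'| ≤ 2 * K * ‖((z.2, m) : Rd d × Rd d) - (z'.2, m')‖ :=
      h.abs_hamiltonian_sub_le (h.norm_momentumField_le hc ht _)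
        (h.norm_momentumField_le hc ht' _)
    have e2 : ‖((z.2, m) : Rd d × Rd d) - (z'.2, m')‖ ≤ 18 * K ^ 2 * ‖z - z'‖ := by
      refine max_le (f2.trans ?_) (h.norm_momentumField_sub_le hs hc ht ht' z.2 z'.2)
      exact le_mul_of_one_le_left f0 (by nlinarith)
    have e3 := h.coupling.abs_sub_le z.2 z'.2 σ
    have e4 : |F z'.2 σ - F z'.2 σ'| ≤ |L| * (K * ‖z - z'‖) :=
      (hL _ _ _).trans (mul_le_mul (le_abs_self L)
        ((h.torusW_flow_le hc ht ht').trans (mul_le_mul_of_nonneg_left f1 hK0))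
        (torusW_nonneg _ _) (abs_nonneg L))
    have e5 : κ * ‖z.2 - z'.2‖ ≤ K * ‖z - z'‖ := mul_le_mul h.κ_le f2 (norm_nonneg _) hK0
    have e6 : 2 * K * ‖((z.2, m) : Rd d × Rd d) - (z'.2, m')‖ ≤
        2 * K * (18 * K ^ 2 * ‖z - z'‖) := mul_le_mul_of_nonneg_left e2 (by positivity)
    have e7 : -H z.2 m - F z.2 σ - (-H z'.2 m' - F z'.2 σ') =
        -((H z.2 m - H z'.2 m') + (F z.2 σ - F z'.2 σ) + (F z'.2 σ - F z'.2 σ')) := by ring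
    rw [e7, abs_neg]
    refine (abs_add_three _ _ _).trans ?_
    linarith
  obtain ⟨w, hw, hw', -⟩ := exists_isWeakDeriv_of_lipschitzOnWith hlip (1, 0)
  exact ⟨v, w, hv, hw, hv', hw'⟩

/-! ### The continuity equation -/

/-- Along the characteristics the continuity equation says that the integral of the time derivative
of a function that vanishes near both ends is zero. -/
theorem continuityEquation (h : IsShortTime H F g κ K T) (hs : s ∈ Icc 0 T)
    (hc : IsCharSystem H F g T s μ Q P) {φ : ℝ × Rd d → ℝ} (hφ : IsTorusTest T φ) :
    ∫ t in Ioo 0 T, ∫ q, (deriv (fun τ => φ (τ, q)) t +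
      inner ℝ (gradient (fun q' => φ (t, q')) q)
        (gradHp H q (gradient (valueFunction H F g μ Q P t) q)))
        ∂(pushforward (Q t) μ : Measure (Rd d)) = 0 := by
  have hdφ : ∀ z, HasFDerivAt φ (fderiv ℝ φ z) z := fun z =>
    (hφ.contDiff.differentiable (by simp) z).hasFDerivAt
  have hcφ : Continuous (fderiv ℝ φ) := hφ.contDiff.continuous_fderiv (by simp)
  have hsplit : ∀ t q w, deriv (fun τ => φ (τ, q)) t
      + inner ℝ (gradient (fun q' => φ (t, q')) q) w = fderiv ℝ φ (t, q) (1, w) := by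
    intro t q w
    have h1 : HasDerivAt (fun τ => φ (τ, q)) (fderiv ℝ φ (t, q) (1, 0)) t :=
      (hdφ (t, q)).comp_hasDerivAt (f := fun τ => (τ, q)) t
        ((hasDerivAt_id t).prodMk (hasDerivAt_const t q))
    have h2 : HasFDerivAt (fun q' => φ (t, q')) _ q :=
      (hdφ (t, q)).comp q (hasFDerivAt_prodMk_right t q)
    rw [h1.deriv, gradient, InnerProductSpace.toDual_symm_apply, h2.fderiv]
    simp [← map_add]
  let D : ℝ → Rd d → ℝ := fun t q => fderiv ℝ φ (t, Q t q) (1, gradHp H (Q t q) (P t q))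
  have hD : ContinuousOn (fun z : ℝ × Rd d => D z.1 z.2) (Icc 0 T ×ˢ univ) :=
    (hcφ.comp_continuousOn (continuousOn_fst.prodMk hc.continuous_Q)).clm_apply
      (continuousOn_const.prodMk (h.hamiltonian.continuous_gradHp.comp_continuousOn
        (hc.continuous_Q.prodMk hc.continuous_P)))
  have hDper : ∀ t ∈ Icc 0 T, TorusPeriodic (D t) := by
    intro t ht q n
    obtain ⟨e1, e2⟩ := h.flow_add_latticeVec hs hc ht q n
    have e3 : fderiv ℝ φ (t, Q t q + latticeVec n) = fderiv ℝ φ (t, Q t q) := by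
      have e4 : (t, Q t q + latticeVec n) = ((t, Q t q) : ℝ × Rd d) + (0, latticeVec n) := by simp
      rw [e4, ← fderiv_comp_add_right]
      congr 1
      refine funext fun z => ?_
      have := hφ.periodic z.1 z.2 n
      simpa [Prod.add_def] using this
    simp only [D, e1, e2, e3, h.hamiltonian.gradHp_add_latticeVec]
  obtain ⟨M, -, hM⟩ := exists_forall_norm_le_of_periodic isCompact_Icc hD hDper
  have hderiv : ∀ t ∈ Icc 0 T, ∀ q,
      HasDerivWithinAt (fun t => φ (t, Q t q)) (D t q) (Icc 0 T) t := fun t ht q =>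
    (hdφ (t, Q t q)).comp_hasDerivWithinAt (f := fun t => (t, Q t q)) t
      ((hasDerivWithinAt_id t _).prodMk ((hc.curve q).deriv_x t ht))
  have hinner : ∀ t ∈ Ioo 0 T, ∫ q, (deriv (fun τ => φ (τ, q)) t +
      inner ℝ (gradient (fun q' => φ (t, q')) q)
        (gradHp H q (gradient (valueFunction H F g μ Q P t) q)))
        ∂(pushforward (Q t) μ : Measure (Rd d)) = ∫ q, D t q ∂(μ : Measure (Rd d)) := by
    intro t ht
    have ht' := Ioo_subset_Icc_self ht
    have hQ := continuous_slice hc.continuous_Q ht'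
    have hm := continuous_slice (h.continuousOn_momentumField hs hc) ht'
    simp only [hsplit, (h.hasGradientAt_valueFunction hs hc ht' _).gradient]
    rw [coe_pushforward hQ, integral_map hQ.measurable.aemeasurable]
    · simp only [h.momentumField_flow hs hc ht', D]
    · refine Continuous.aestronglyMeasurable ?_
      exact (hcφ.comp (by fun_prop)).clm_apply (continuous_const.prodMk
        (h.hamiltonian.continuous_gradHp.comp (continuous_id.prodMk hm)))
  rw [setIntegral_congr_fun measurableSet_Ioo hinner]
  have hint : Integrable (Function.uncurry D)
      ((volume.restrict (Ioo 0 T)).prod (μ : Measure (Rd d))) := by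
    have hcyl : MeasurableSet (Ioo 0 T ×ˢ (univ : Set (Rd d))) :=
      measurableSet_Ioo.prod MeasurableSet.univ
    have hrestrict : (volume.restrict (Ioo 0 T)).prod (μ : Measure (Rd d)) =
        ((volume : Measure ℝ).prod (μ : Measure (Rd d))).restrict (Ioo 0 T ×ˢ univ) := by
      rw [← Measure.prod_restrict, Measure.restrict_univ]
    have hmeas : AEStronglyMeasurable (Function.uncurry D)
        ((volume.restrict (Ioo 0 T)).prod (μ : Measure (Rd d))) := by
      rw [hrestrict]
      exact (hD.mono (prod_mono_left Ioo_subset_Icc_self)).aestronglyMeasurable hcyl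
    refine Integrable.of_bound hmeas M ?_
    rw [hrestrict]
    filter_upwards [ae_restrict_mem hcyl] with z hz
    exact hM z.1 (Ioo_subset_Icc_self hz.1) z.2
  rw [integral_integral_swap hint]
  obtain ⟨a, b, ha, hb, hab⟩ := hφ.support
  refine integral_eq_zero_of_ae (Eventually.of_forall fun q => ?_)
  have hftc : ∫ t in (0 : ℝ)..T, D t q = φ (T, Q T q) - φ (0, Q 0 q) :=
    intervalIntegral.integral_eq_sub_of_hasDerivAt_of_le h.T_pos.le
      (fun t ht => (hderiv t ht q).continuousWithinAt)
      (fun t ht => (hderiv t (Ioo_subset_Icc_self ht) q).hasDerivAt (Icc_mem_nhds ht.1 ht.2))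
      ((continuousOn_slice_time hD q).intervalIntegrable_of_Icc h.T_pos.le)
  rw [hab T fun hT => absurd hT.2 (not_le.2 hb), hab 0 fun h0 => absurd h0.1 (not_le.2 ha),
    sub_zero, intervalIntegral.integral_of_le h.T_pos.le, integral_Ioc_eq_integral_Ioo] at hftc
  exact hftc

/-! ### The classical solution -/

lemma isAC2_flow (h : IsShortTime H F g κ K T) (hc : IsCharSystem H F g T s μ Q P) :
    IsAC2 T fun t => pushforward (Q t) μ := by
  refine ⟨fun _ => K, memLp_const K, fun t₁ t₂ h1 h12 h2 => ?_⟩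
  have h3 := h.torusW_flow_le hc (t := t₁) (t' := t₂) ⟨h1.le, h12.trans h2.le⟩
    ⟨h1.le.trans h12, h2.le⟩
  rw [abs_sub_comm, abs_of_nonneg (sub_nonneg.2 h12)] at h3
  rw [intervalIntegral.integral_const, smul_eq_mul, mul_comm]
  exact h3

theorem isClassicalSolution (h : IsShortTime H F g κ K T) (hs : s ∈ Icc 0 T)
    (hc : IsCharSystem H F g T s μ Q P) :
    IsClassicalSolution H F g T s μ (valueFunction H F g μ Q P)
      (fun t => pushforward (Q t) μ) where
  periodic t ht := h.valueFunction_periodic hs hc (Ico_subset_Icc_self ht)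
  contDiff := h.contDiffOn_valueFunction hs hc
  continuous := (h.continuousOn_valueFunction hs hc).mono (prod_mono_left Ico_subset_Icc_self)
  ac2 := h.isAC2_flow hc
  tendsto_zero := by
    have hlim : Tendsto (fun t : ℝ => K * |t - 0|) (𝓝[>] 0) (𝓝 0) :=
      (Continuous.tendsto' (by fun_prop) _ _ (by simp)).mono_left nhdsWithin_le_nhds
    refine squeeze_zero' (Eventually.of_forall fun _ => torusW_nonneg _ _) ?_ hlim
    filter_upwards [Ioc_mem_nhdsGT h.T_pos] with t ht
    exact h.torusW_flow_le hc (Ioc_subset_Icc_self ht) h.zero_mem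
  hamiltonJacobi t ht q := by
    rw [(h.hasDerivAt_valueFunction hs hc ht q).deriv,
      (h.hasGradientAt_valueFunction hs hc (Ioo_subset_Icc_self ht) q).gradient]
    ring
  continuityEquation φ hφ := h.continuityEquation hs hc hφ
  initial q := by
    simp only [valueFunction, characteristicValue, intervalIntegral.integral_same, add_zero,
      h.flow_invFun hs hc h.zero_mem]
  terminal := by
    have hid := pushforward_eq_self (f := Q s) (fun q => (hc.curve q).terminal) μ
    intro φ _ _
    rw [hid]

end IsShortTime

end MFG

open MFG
theorem mainTheorem2 (d : ℕ) (H : Rd d → Rd d → ℝ)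
    (F g : Rd d → ProbabilityMeasure (Rd d) → ℝ) (κ : ℝ) (hκ : 0 < κ)
    (hH : IsHamiltonian H) (hF : IsCoupling κ F) (hg : IsCoupling κ g) :
    ∃ T₀ > 0, ∀ T : ℝ, 0 < T → T ≤ T₀ → ∀ s ∈ Ioo 0 T, ∀ μ : ProbabilityMeasure (Rd d),
      ∃ Q P : ℝ → Rd d → Rd d,
        -- `(Q, P)` is the unique solution of the characteristic system
        IsCharacteristicFlow H F g T s μ Q P ∧
        (∀ Q' P' : ℝ → Rd d → Rd d, IsCharacteristicFlow H F g T s μ Q' P' →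
          ∀ t ∈ Icc 0 T, Q' t = Q t ∧ P' t = P t) ∧
        (∀ t ∈ Icc 0 T, Function.Bijective (Q t)) ∧
        -- the pair built from it is a classical solution
        IsClassicalSolution H F g T s μ (valueFunction H F g μ Q P)
          (fun t => pushforward (Q t) μ) ∧
        (∀ t ∈ Icc 0 T, ∀ q,
          HasGradientAt (valueFunction H F g μ Q P t) (P t q) (Q t q)) ∧
        IsAC2 T (fun t => pushforward (Q t) μ) ∧
        MemW12 T (valueFunction H F g μ Q P) ∧
        ((∃ L : ℝ, ∀ q ν₁ ν₂, |F q ν₁ - F q ν₂| ≤ L * torusW ν₁ ν₂) →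
          MemW22 T (valueFunction H F g μ Q P)) := by
  obtain ⟨K, T₀, hT₀, hK⟩ := exists_short_time hκ hH hF hg
  refine ⟨T₀, hT₀, fun T hT hTT₀ s hs' μ => ?_⟩
  obtain ⟨h, hex⟩ := hK T hT hTT₀
  have hs : s ∈ Icc 0 T := Ioo_subset_Icc_self hs'
  obtain ⟨Q, P, hc⟩ := hex s hs μ
  refine ⟨Q, P, h.isCharacteristicFlow hs hc,
    fun Q' P' hc' t ht => h.flow_unique hs hc hc'.isCharSystem ht,
    fun t ht => h.bijective hs hc ht, h.isClassicalSolution hs hc, fun t ht q => ?_,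
    h.isAC2_flow hc, h.memW12_valueFunction hs hc, fun ⟨L, hL⟩ => h.memW22_valueFunction hs hc hL⟩
  have hgrad := h.hasGradientAt_valueFunction hs hc ht (Q t q)
  rwa [h.momentumField_flow hs hc ht] at hgrad
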